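/- Let $\mathbb R^{1,3}$ be Minkowski space with metric $g=\mathrm{diag}(-1,1,1,1)$, $t=x^0$, $\Box=\partial_\mu\partial^\mu$, and let $J$ be the set of causal vectors ($x\neq0$, $x_\mu x^\mu\le 0$). A function $f$ on $\mathbb R^{1,3}$ is called space-compact if $\operatorname{supp} f\subset K+J$ for some compact $K$. All vector fields $\zeta=(\zeta_\mu)$ below are real. Let - $\mathcal Y_{\widetilde{\rm Max}}$ be the space of smooth space-compact solutions of the Maxwell equation $-\partial_\mu(\partial^\mu\zeta^\nu-\partial^\nu\zeta^\mu)=0$, with the presymplectic form $\zeta_1\,\omega_{\widetilde{\rm Max}}\,\zeta_2=\int_{\mathbb R^3} j^0_{\widetilde{\rm Max}}(\zeta_1,\zeta_2;t,\vec x)\,d\vec x$, where $$j^\mu_{\widetilde{\rm Max}}(\zeta_1,\zeta_2,x)=(\partial^\mu\zeta_{1\nu}-\partial_\nu\zeta_1^\mu)\zeta_2^\nu-\zeta_{1\nu}(\partial^\mu\zeta_2^\nu-\partial^\nu\zeta_2^\mu);$$ - $\mathcal Y_{\rm Max}=\mathcal Y_{\widetilde{\rm Max}}/\operatorname{Ker}\omega_{\widetilde{\rm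 Max}}$, with the induced symplectic form $\omega_{\rm Max}$; - $\mathcal Y_{\rm vec}$ be the space of smooth space-compact solutions of $-\Box\zeta_\mu=0$, with the form $\zeta_1\,\omega_{\rm vec}\,\zeta_2=\int_{\mathbb R^3} j^0_{\rm vec}(\zeta_1,\zeta_2;t,\vec x)\,d\vec x$, where $j^\mu_{\rm vec}(\zeta_1,\zeta_2,x)=\partial^\mu\zeta_{1\nu}\,\zeta_2^\nu-\zeta_{1\nu}\,\partial^\mu\zeta_2^\nu$; - $\mathcal Y_{\rm Lor}=\{\zeta\in\mathcal Y_{\rm vec}:\ \partial_\mu\zeta^\mu=0\}$. Call $\zeta$ and $\eta$ gauge equivalent if $\eta_\mu=\zeta_\mu+\partial_\mu\chi$ for some smooth $\chi:\mathbb R^{1,3}\to\mathbb R$. **Proposition.** Every $\zeta\in\mathcal Y_{\widetilde{\rm Max}}$ is gauge equivalent to an element of $\mathcal Y_{\rm Lor}$. Moreover, for every time $t$ used to define the two forms, $\mathcal Y_{\rm Lor}\subset\mathcal Y_{\widetilde{\rm Max}}$, and this inclusion induces a linear isomorphism of the symplectic reduction $\mathcal Y_{\rm Lor}/\operatorname{Ker}\bigl(\omega_{\rm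 vec}|_{\mathcal Y_{\rm Lor}}\bigr)$ onto $\mathcal Y_{\rm Max}$, which carries the form induced by $\omega_{\rm vec}$ to $\omega_{\rm Max}$. -/

import Mathlib

open MeasureTheory Set
open scoped ContDiff Pointwise

noncomputable section

namespace MaxwellFields

/-! ### Minkowski space -/

/-- Minkowski space `ℝ^{1,3}` with coordinates `x⁰, x¹, x², x³`. -/
abbrev Minkowski : Type := Fin 4 → ℝ

/-- The diagonal entries of the metric `g_{μν}` of signature `(- + + +)`
(and also of its inverse `g^{μν}`). -/
def sig : Fin 4 → ℝ := ![-1, 1, 1, 1]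

/-- The pseudo-Euclidean square `x_μ x^μ`. -/
def minkowskiSq (x : Minkowski) : ℝ := ∑ μ, sig μ * x μ * x μ

/-- The set `J = J⁺ ∪ J⁻` of causal vectors. -/
def causalCone : Set Minkowski := {x | x ≠ 0 ∧ minkowskiSq x ≤ 0}

/-- `f` is space-compact: its support lies in the causal shadow `J(K) = K + J` of a compact `K`. -/
def SpaceCompact {E : Type*} [Zero E] (f : Minkowski → E) : Prop :=
  ∃ K : Set Minkowski, IsCompact K ∧ tsupport f ⊆ K + causalCone

/-- The partial derivative `∂_μ f = ∂f/∂x^μ`. -/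
def pd (μ : Fin 4) (f : Minkowski → ℝ) (x : Minkowski) : ℝ := fderiv ℝ f x (Pi.single μ 1)

/-- `∂^μ f = g^{μν} ∂_ν f`. -/
def pdUp (μ : Fin 4) (f : Minkowski → ℝ) (x : Minkowski) : ℝ := sig μ * pd μ f x

/-- The d'Alembertian `□ f = ∂_μ ∂^μ f`. -/
def dAlembertian (f : Minkowski → ℝ) (x : Minkowski) : ℝ := ∑ μ, pd μ (pdUp μ f) x

/-- A real vector field, given by its covariant components: `ζ x μ = ζ_μ(x)`. -/
abbrev Potential : Type := Minkowski → Fin 4 → ℝ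

/-- The covariant component `ζ_μ`. -/
def low (ζ : Potential) (μ : Fin 4) (x : Minkowski) : ℝ := ζ x μ

/-- The contravariant component `ζ^μ = g^{μν} ζ_ν`. -/
def up (ζ : Potential) (μ : Fin 4) (x : Minkowski) : ℝ := sig μ * ζ x μ

/-- Gauge equivalence: `η_μ = ζ_μ + ∂_μ χ` for some smooth function `χ` on space-time. -/
def GaugeEquivalent (ζ η : Potential) : Prop :=
  ∃ χ : Minkowski → ℝ, ContDiff ℝ ∞ χ ∧ ∀ x μ, η x μ = ζ x μ + pd μ χ x

/-! ### Elementary facts used by the definitions below -/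

lemma pd_add {f g : Minkowski → ℝ} (hf : Differentiable ℝ f) (hg : Differentiable ℝ g)
    (μ : Fin 4) : pd μ (f + g) = pd μ f + pd μ g := by
  funext x
  simp [pd, fderiv_add (hf x) (hg x)]

lemma pd_smul {f : Minkowski → ℝ} (hf : Differentiable ℝ f) (c : ℝ)
    (μ : Fin 4) : pd μ (c • f) = c • pd μ f := by
  funext x
  simp [pd, fderiv_const_smul (hf x)]

lemma pd_zero (μ : Fin 4) : pd μ (0 : Minkowski → ℝ) = 0 := by
  funext x
  have : (0 : Minkowski → ℝ) = fun _ => 0 := rfl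
  simp [pd, this]

lemma pdUp_eq (μ : Fin 4) (f : Minkowski → ℝ) : pdUp μ f = sig μ • pd μ f := by
  funext x; simp [pdUp]

lemma pdUp_add {f g : Minkowski → ℝ} (hf : Differentiable ℝ f) (hg : Differentiable ℝ g)
    (μ : Fin 4) : pdUp μ (f + g) = pdUp μ f + pdUp μ g := by
  simp [pdUp_eq, pd_add hf hg]

lemma pdUp_smul {f : Minkowski → ℝ} (hf : Differentiable ℝ f) (c : ℝ)
    (μ : Fin 4) : pdUp μ (c • f) = c • pdUp μ f := by
  rw [pdUp_eq, pdUp_eq, pd_smul hf, smul_comm]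

lemma pdUp_zero (μ : Fin 4) : pdUp μ (0 : Minkowski → ℝ) = 0 := by
  simp [pdUp_eq, pd_zero]

lemma smooth_pd {f : Minkowski → ℝ} (hf : ContDiff ℝ ∞ f) (μ : Fin 4) :
    ContDiff ℝ ∞ (pd μ f) :=
  (hf.fderiv_right (m := ∞) (by simp)).clm_apply contDiff_const

lemma smooth_pdUp {f : Minkowski → ℝ} (hf : ContDiff ℝ ∞ f) (μ : Fin 4) :
    ContDiff ℝ ∞ (pdUp μ f) :=
  contDiff_const.mul (smooth_pd hf μ)

lemma smooth_low {ζ : Potential} (hζ : ContDiff ℝ ∞ ζ) (μ : Fin 4) :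
    ContDiff ℝ ∞ (low ζ μ) :=
  (contDiff_pi.1 hζ) μ

lemma smooth_up {ζ : Potential} (hζ : ContDiff ℝ ∞ ζ) (μ : Fin 4) :
    ContDiff ℝ ∞ (up ζ μ) :=
  contDiff_const.mul (smooth_low hζ μ)

lemma diff_of_smooth {f : Minkowski → ℝ} (hf : ContDiff ℝ ∞ f) : Differentiable ℝ f :=
  hf.differentiable (by simp)

lemma low_add (ζ η : Potential) (μ : Fin 4) : low (ζ + η) μ = low ζ μ + low η μ := rfl

lemma low_smul (c : ℝ) (ζ : Potential) (μ : Fin 4) : low (c • ζ) μ = c • low ζ μ := rfl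

lemma low_zero (μ : Fin 4) : low 0 μ = 0 := rfl

lemma up_add (ζ η : Potential) (μ : Fin 4) : up (ζ + η) μ = up ζ μ + up η μ := by
  funext x; simp [up, mul_add]

lemma up_smul (c : ℝ) (ζ : Potential) (μ : Fin 4) : up (c • ζ) μ = c • up ζ μ := by
  funext x; simp [up]; ring

lemma up_zero (μ : Fin 4) : up 0 μ = 0 := by
  funext x; simp [up]

/-! ### Smooth space-compact vector fields -/

/-- Smooth space-compact real vector fields. -/
def smoothSC : Submodule ℝ Potential where
  carrier := {ζ | ContDiff ℝ ∞ ζ ∧ SpaceCompact ζ}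
  add_mem' := by
    rintro ζ η ⟨hζ, K, hK, hKs⟩ ⟨hη, L, hL, hLs⟩
    refine ⟨hζ.add hη, K ∪ L, hK.union hL, ?_⟩
    rw [union_add]
    exact (tsupport_add ζ η).trans (union_subset_union hKs hLs)
  zero_mem' := by
    refine ⟨contDiff_const, ∅, isCompact_empty, ?_⟩
    have : tsupport (0 : Potential) = ∅ := by simp
    simp [this]
  smul_mem' := by
    rintro c ζ ⟨hζ, K, hK, hKs⟩
    exact ⟨contDiff_const.smul hζ, K, hK,
      (tsupport_smul_subset_right (fun _ => c) ζ).trans hKs⟩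

/-! ### Spaces of solutions -/

/-- `∂_μ (∂^μ ζ^ν - ∂^ν ζ^μ)`. -/
def maxwellOp (ζ : Potential) (ν : Fin 4) (x : Minkowski) : ℝ :=
  ∑ μ, pd μ (pdUp μ (up ζ ν) - pdUp ν (up ζ μ)) x

/-- The four-divergence `∂_μ ζ^μ`. -/
def divergence (ζ : Potential) (x : Minkowski) : ℝ := ∑ μ, pd μ (up ζ μ) x

/-- `𝒴_{Max~}`: smooth real space-compact solutions of the Maxwell equation
`-∂_μ (∂^μ ζ^ν - ∂^ν ζ^μ) = 0`. -/
def YMaxTilde : Submodule ℝ Potential where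
  carrier := {ζ | ζ ∈ smoothSC ∧ ∀ ν x, -maxwellOp ζ ν x = 0}
  add_mem' := by
    rintro ζ η ⟨hζ, eζ⟩ ⟨hη, eη⟩
    refine ⟨smoothSC.add_mem hζ hη, fun ν x => ?_⟩
    have hd : ∀ {ζ : Potential}, ζ ∈ smoothSC → ∀ μ ν,
        Differentiable ℝ (pdUp μ (up ζ ν) - pdUp ν (up ζ μ)) := fun h μ ν =>
      (diff_of_smooth (smooth_pdUp (smooth_up h.1 _) _)).sub
        (diff_of_smooth (smooth_pdUp (smooth_up h.1 _) _))
    have key : maxwellOp (ζ + η) ν x = maxwellOp ζ ν x + maxwellOp η ν x := by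
      rw [maxwellOp, maxwellOp, maxwellOp, ← Finset.sum_add_distrib]
      refine Finset.sum_congr rfl fun μ _ => ?_
      rw [← Pi.add_apply (pd μ _), ← pd_add (hd hζ _ _) (hd hη _ _), up_add, up_add,
        pdUp_add (diff_of_smooth (smooth_up hζ.1 _)) (diff_of_smooth (smooth_up hη.1 _)),
        pdUp_add (diff_of_smooth (smooth_up hζ.1 _)) (diff_of_smooth (smooth_up hη.1 _)),
        add_sub_add_comm]
    rw [key, neg_add, eζ, eη, add_zero]
  zero_mem' := by
    refine ⟨smoothSC.zero_mem, fun ν x => ?_⟩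
    simp [maxwellOp, up_zero, pdUp_zero, pd_zero]
  smul_mem' := by
    rintro c ζ ⟨hζ, eζ⟩
    refine ⟨smoothSC.smul_mem c hζ, fun ν x => ?_⟩
    have key : maxwellOp (c • ζ) ν x = c * maxwellOp ζ ν x := by
      rw [maxwellOp, maxwellOp, Finset.mul_sum]
      refine Finset.sum_congr rfl fun μ _ => ?_
      rw [up_smul, up_smul, pdUp_smul (diff_of_smooth (smooth_up hζ.1 _)),
        pdUp_smul (diff_of_smooth (smooth_up hζ.1 _)), ← smul_sub,
        pd_smul ((diff_of_smooth (smooth_pdUp (smooth_up hζ.1 _) _)).sub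
          (diff_of_smooth (smooth_pdUp (smooth_up hζ.1 _) _)))]
      rfl
    rw [key, ← mul_neg, eζ, mul_zero]

/-- `𝒴_vec` (for mass zero): smooth real space-compact solutions of `-□ ζ_μ = 0`. -/
def YVec : Submodule ℝ Potential where
  carrier := {ζ | ζ ∈ smoothSC ∧ ∀ ν x, -dAlembertian (low ζ ν) x = 0}
  add_mem' := by
    rintro ζ η ⟨hζ, eζ⟩ ⟨hη, eη⟩
    refine ⟨smoothSC.add_mem hζ hη, fun ν x => ?_⟩
    have key : dAlembertian (low (ζ + η) ν) x
        = dAlembertian (low ζ ν) x + dAlembertian (low η ν) x := by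
      rw [dAlembertian, dAlembertian, dAlembertian, ← Finset.sum_add_distrib]
      refine Finset.sum_congr rfl fun μ _ => ?_
      rw [low_add,
        pdUp_add (diff_of_smooth (smooth_low hζ.1 _)) (diff_of_smooth (smooth_low hη.1 _)),
        pd_add (diff_of_smooth (smooth_pdUp (smooth_low hζ.1 _) _))
          (diff_of_smooth (smooth_pdUp (smooth_low hη.1 _) _))]
      rfl
    rw [key, neg_add, eζ, eη, add_zero]
  zero_mem' := by
    refine ⟨smoothSC.zero_mem, fun ν x => ?_⟩
    simp [dAlembertian, low_zero, pdUp_zero, pd_zero]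
  smul_mem' := by
    rintro c ζ ⟨hζ, eζ⟩
    refine ⟨smoothSC.smul_mem c hζ, fun ν x => ?_⟩
    have key : dAlembertian (low (c • ζ) ν) x = c * dAlembertian (low ζ ν) x := by
      rw [dAlembertian, dAlembertian, Finset.mul_sum]
      refine Finset.sum_congr rfl fun μ _ => ?_
      rw [low_smul, pdUp_smul (diff_of_smooth (smooth_low hζ.1 _)),
        pd_smul (diff_of_smooth (smooth_pdUp (smooth_low hζ.1 _) _))]
      rfl
    rw [key, ← mul_neg, eζ, mul_zero]

/-- `𝒴_Lor`: the elements of `𝒴_vec` satisfying the Lorentz condition `∂_μ ζ^μ = 0`. -/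
def YLor : Submodule ℝ Potential where
  carrier := {ζ | ζ ∈ YVec ∧ ∀ x, divergence ζ x = 0}
  add_mem' := by
    rintro ζ η ⟨hζ, eζ⟩ ⟨hη, eη⟩
    refine ⟨YVec.add_mem hζ hη, fun x => ?_⟩
    have key : divergence (ζ + η) x = divergence ζ x + divergence η x := by
      rw [divergence, divergence, divergence, ← Finset.sum_add_distrib]
      refine Finset.sum_congr rfl fun μ _ => ?_
      rw [up_add, pd_add (diff_of_smooth (smooth_up hζ.1.1 _))
        (diff_of_smooth (smooth_up hη.1.1 _))]
      rfl
    rw [key, eζ, eη, add_zero]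
  zero_mem' := by
    refine ⟨YVec.zero_mem, fun x => ?_⟩
    simp [divergence, up_zero, pd_zero]
  smul_mem' := by
    rintro c ζ ⟨hζ, eζ⟩
    refine ⟨YVec.smul_mem c hζ, fun x => ?_⟩
    have key : divergence (c • ζ) x = c * divergence ζ x := by
      rw [divergence, divergence, Finset.mul_sum]
      refine Finset.sum_congr rfl fun μ _ => ?_
      rw [up_smul, pd_smul (diff_of_smooth (smooth_up hζ.1.1 _))]
      rfl
    rw [key, eζ, mul_zero]

lemma YLor_le_YVec : YLor ≤ YVec := fun _ h => h.1

/-! ### Conserved currents and (pre)symplectic forms -/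

/-- The point `(t, x⃗)` of space-time. -/
def spacetime (t : ℝ) (x : Fin 3 → ℝ) : Minkowski := Fin.cons t x

/-- The current
`j_{Max~}^μ = (∂^μ ζ_{1ν} - ∂_ν ζ_1^μ) ζ_2^ν - ζ_{1ν} (∂^μ ζ_2^ν - ∂^ν ζ_2^μ)`. -/
def jMax (μ : Fin 4) (ζ η : Potential) (x : Minkowski) : ℝ :=
  ∑ ν, ((pdUp μ (low ζ ν) x - pd ν (up ζ μ) x) * up η ν x
    - low ζ ν x * (pdUp μ (up η ν) x - pdUp ν (up η μ) x))

/-- The current `j_vec^μ = ∂^μ ζ_{1ν} ζ_2^ν - ζ_{1ν} ∂^μ ζ_2^ν`. -/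
def jVec (μ : Fin 4) (ζ η : Potential) (x : Minkowski) : ℝ :=
  ∑ ν, (pdUp μ (low ζ ν) x * up η ν x - low ζ ν x * pdUp μ (up η ν) x)

/-- The flux of a current through the Cauchy surface `{x⁰ = t}`. -/
def flux (t : ℝ) (j : Fin 4 → Minkowski → ℝ) : ℝ := ∫ x : Fin 3 → ℝ, j 0 (spacetime t x)

lemma continuous_spacetime (t : ℝ) : Continuous (spacetime t) := by
  refine continuous_pi fun i => ?_
  refine Fin.cases ?_ (fun k => ?_) i
  · simpa [spacetime] using continuous_const
  · simpa [spacetime] using continuous_apply k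

lemma causal_bound {x : Minkowski} (hx : x ∈ causalCone) (i : Fin 3) : |x i.succ| ≤ |x 0| := by
  have h := hx.2
  simp only [minkowskiSq, sig, Fin.sum_univ_four] at h
  simp at h
  rw [← sq_le_sq]
  fin_cases i <;> simp <;> nlinarith [sq_nonneg (x 1), sq_nonneg (x 2), sq_nonneg (x 3)]

lemma slice_compact {ζ : Potential} (hζ : SpaceCompact ζ) (t : ℝ) :
    ∃ C : Set (Fin 3 → ℝ), IsCompact C ∧ ∀ x ∉ C, ζ (spacetime t x) = 0 := by
  obtain ⟨K, hK, hs⟩ := hζ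
  obtain ⟨R, hR⟩ := hK.isBounded.exists_norm_le
  refine ⟨Metric.closedBall 0 (R + (|t| + R)), isCompact_closedBall _ _, fun x hx => ?_⟩
  by_contra hne
  apply hx
  obtain ⟨k, hk, c, hc, hkc⟩ := hs (subset_tsupport _ hne)
  have hk' : ∀ i, |k i| ≤ R := fun i => (norm_le_pi_norm k i).trans (hR k hk)
  have e0 : k 0 + c 0 = t := congrFun hkc 0
  have hR0 : 0 ≤ R := (abs_nonneg _).trans (hk' 0)
  rw [mem_closedBall_zero_iff, pi_norm_le_iff_of_nonneg (by positivity)]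
  intro i
  have ei : k i.succ + c i.succ = x i := congrFun hkc i.succ
  have hci := causal_bound hc i
  have h0 : |c 0| ≤ |t| + R := by
    rw [← sub_eq_of_eq_add' e0.symm]
    exact (abs_sub _ _).trans (add_le_add le_rfl (hk' 0))
  rw [← ei, Real.norm_eq_abs]
  exact (abs_add_le _ _).trans (add_le_add (hk' _) (hci.trans h0))

lemma integrable_slice {ζ : Potential} (hζ : ζ ∈ smoothSC) {f g : Minkowski → ℝ}
    (hf : Continuous f) (hg : Continuous g) (h0 : ∀ x, ζ x = 0 → g x = 0) (t : ℝ) :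
    Integrable (fun x => f (spacetime t x) * g (spacetime t x)) := by
  obtain ⟨C, hC, hCs⟩ := slice_compact hζ.2 t
  refine Continuous.integrable_of_hasCompactSupport
    ((hf.comp (continuous_spacetime t)).mul (hg.comp (continuous_spacetime t))) ?_
  exact HasCompactSupport.intro hC fun x hx => by simp [h0 _ (hCs x hx)]

lemma integrable_jMax {ζ η : Potential} (hζ : ζ ∈ smoothSC) (hη : η ∈ smoothSC)
    (μ : Fin 4) (t : ℝ) : Integrable (fun x => jMax μ ζ η (spacetime t x)) := by
  unfold jMax
  refine integrable_finsetSum _ fun ν _ => Integrable.sub ?_ ?_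
  · exact integrable_slice hη (f := fun x => pdUp μ (low ζ ν) x - pd ν (up ζ μ) x)
      ((smooth_pdUp (smooth_low hζ.1 _) _).continuous.sub
        (smooth_pd (smooth_up hζ.1 _) _).continuous)
      (smooth_up hη.1 ν).continuous (fun x hx => by simp [up, hx]) t
  · have := integrable_slice hζ (f := fun x => pdUp μ (up η ν) x - pdUp ν (up η μ) x)
      ((smooth_pdUp (smooth_up hη.1 _) _).continuous.sub
        (smooth_pdUp (smooth_up hη.1 _) _).continuous)
      (smooth_low hζ.1 ν).continuous (fun x hx => by simp [low, hx]) t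
    simpa only [mul_comm] using this

lemma integrable_jVec {ζ η : Potential} (hζ : ζ ∈ smoothSC) (hη : η ∈ smoothSC)
    (μ : Fin 4) (t : ℝ) : Integrable (fun x => jVec μ ζ η (spacetime t x)) := by
  unfold jVec
  refine integrable_finsetSum _ fun ν _ => Integrable.sub ?_ ?_
  · exact integrable_slice hη (smooth_pdUp (smooth_low hζ.1 _) _).continuous
      (smooth_up hη.1 ν).continuous (fun x hx => by simp [up, hx]) t
  · have := integrable_slice hζ (smooth_pdUp (smooth_up hη.1 ν) μ).continuous
      (smooth_low hζ.1 ν).continuous (fun x hx => by simp [low, hx]) t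
    simpa only [mul_comm] using this

lemma jMax_add_left {ζ ζ' : Potential} (hζ : ζ ∈ smoothSC) (hζ' : ζ' ∈ smoothSC)
    (η : Potential) (μ : Fin 4) (x : Minkowski) :
    jMax μ (ζ + ζ') η x = jMax μ ζ η x + jMax μ ζ' η x := by
  rw [jMax, jMax, jMax, ← Finset.sum_add_distrib]
  refine Finset.sum_congr rfl fun ν _ => ?_
  rw [low_add, up_add,
    pdUp_add (diff_of_smooth (smooth_low hζ.1 _)) (diff_of_smooth (smooth_low hζ'.1 _)),
    pd_add (diff_of_smooth (smooth_up hζ.1 _)) (diff_of_smooth (smooth_up hζ'.1 _))]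
  simp only [Pi.add_apply]
  ring

lemma jMax_smul_left {ζ : Potential} (hζ : ζ ∈ smoothSC) (c : ℝ)
    (η : Potential) (μ : Fin 4) (x : Minkowski) :
    jMax μ (c • ζ) η x = c * jMax μ ζ η x := by
  rw [jMax, jMax, Finset.mul_sum]
  refine Finset.sum_congr rfl fun ν _ => ?_
  rw [low_smul, up_smul, pdUp_smul (diff_of_smooth (smooth_low hζ.1 _)),
    pd_smul (diff_of_smooth (smooth_up hζ.1 _))]
  simp only [Pi.smul_apply, smul_eq_mul]
  ring

lemma up_eq (ζ : Potential) (μ : Fin 4) : up ζ μ = sig μ • low ζ μ := rfl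

lemma jMax_antisymm {ζ η : Potential} (hζ : ζ ∈ smoothSC) (hη : η ∈ smoothSC)
    (μ : Fin 4) (x : Minkowski) : jMax μ ζ η x = -jMax μ η ζ x := by
  rw [jMax, jMax, ← Finset.sum_neg_distrib]
  refine Finset.sum_congr rfl fun ν _ => ?_
  simp only [up_eq, pdUp_eq, pd_smul (diff_of_smooth (smooth_low hζ.1 _)),
    pd_smul (diff_of_smooth (smooth_low hη.1 _)), Pi.smul_apply, smul_eq_mul]
  ring

lemma jVec_add_left {ζ ζ' : Potential} (hζ : ζ ∈ smoothSC) (hζ' : ζ' ∈ smoothSC)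
    (η : Potential) (μ : Fin 4) (x : Minkowski) :
    jVec μ (ζ + ζ') η x = jVec μ ζ η x + jVec μ ζ' η x := by
  rw [jVec, jVec, jVec, ← Finset.sum_add_distrib]
  refine Finset.sum_congr rfl fun ν _ => ?_
  rw [low_add,
    pdUp_add (diff_of_smooth (smooth_low hζ.1 _)) (diff_of_smooth (smooth_low hζ'.1 _))]
  simp only [Pi.add_apply]
  ring

lemma jVec_smul_left {ζ : Potential} (hζ : ζ ∈ smoothSC) (c : ℝ)
    (η : Potential) (μ : Fin 4) (x : Minkowski) :
    jVec μ (c • ζ) η x = c * jVec μ ζ η x := by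
  rw [jVec, jVec, Finset.mul_sum]
  refine Finset.sum_congr rfl fun ν _ => ?_
  rw [low_smul, pdUp_smul (diff_of_smooth (smooth_low hζ.1 _))]
  simp only [Pi.smul_apply, smul_eq_mul]
  ring

lemma jVec_antisymm {ζ η : Potential} (hζ : ζ ∈ smoothSC) (hη : η ∈ smoothSC)
    (μ : Fin 4) (x : Minkowski) : jVec μ ζ η x = -jVec μ η ζ x := by
  rw [jVec, jVec, ← Finset.sum_neg_distrib]
  refine Finset.sum_congr rfl fun ν _ => ?_
  simp only [up_eq, pdUp_eq, pd_smul (diff_of_smooth (smooth_low hζ.1 _)),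
    pd_smul (diff_of_smooth (smooth_low hη.1 _)), Pi.smul_apply, smul_eq_mul]
  ring

/-- The presymplectic form `ζ ω_{Max~} η = ∫_{x⁰ = t} j_{Max~}^μ(ζ, η, x) ds_μ(x)`
on `𝒴_{Max~}`. -/
def omegaMaxTilde (t : ℝ) : LinearMap.BilinForm ℝ YMaxTilde :=
  have add_l : ∀ a b c : YMaxTilde, flux t (fun μ => jMax μ (a + b : YMaxTilde) c)
      = flux t (fun μ => jMax μ a c) + flux t (fun μ => jMax μ b c) := fun a b c => by
    simp only [flux, Submodule.coe_add, jMax_add_left a.2.1 b.2.1]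
    exact integral_add (integrable_jMax a.2.1 c.2.1 0 t) (integrable_jMax b.2.1 c.2.1 0 t)
  have smul_l : ∀ (r : ℝ) (a c : YMaxTilde), flux t (fun μ => jMax μ (r • a : YMaxTilde) c)
      = r • flux t (fun μ => jMax μ a c) := fun r a c => by
    simp only [flux, Submodule.coe_smul, jMax_smul_left a.2.1, integral_const_mul, smul_eq_mul]
  have anti : ∀ a c : YMaxTilde, flux t (fun μ => jMax μ a c) = -flux t (fun μ => jMax μ c a) :=
    fun a c => by
      rw [flux, flux, ← integral_neg]
      exact integral_congr_ae (.of_forall fun x => jMax_antisymm a.2.1 c.2.1 0 _)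
  LinearMap.mk₂ ℝ (fun ζ η => flux t fun μ => jMax μ (ζ : Potential) (η : Potential))
    add_l smul_l
    (fun a b c => by rw [anti, add_l, neg_add, ← anti, ← anti])
    (fun r a c => by rw [anti, smul_l, ← smul_neg, ← anti])

/-- The form `ζ ω_vec η = ∫_{x⁰ = t} j_vec^μ(ζ, η, x) ds_μ(x)` on `𝒴_vec`. -/
def omegaVec (t : ℝ) : LinearMap.BilinForm ℝ YVec :=
  have add_l : ∀ a b c : YVec, flux t (fun μ => jVec μ (a + b : YVec) c)
      = flux t (fun μ => jVec μ a c) + flux t (fun μ => jVec μ b c) := fun a b c => by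
    simp only [flux, Submodule.coe_add, jVec_add_left a.2.1 b.2.1]
    exact integral_add (integrable_jVec a.2.1 c.2.1 0 t) (integrable_jVec b.2.1 c.2.1 0 t)
  have smul_l : ∀ (r : ℝ) (a c : YVec), flux t (fun μ => jVec μ (r • a : YVec) c)
      = r • flux t (fun μ => jVec μ a c) := fun r a c => by
    simp only [flux, Submodule.coe_smul, jVec_smul_left a.2.1, integral_const_mul, smul_eq_mul]
  have anti : ∀ a c : YVec, flux t (fun μ => jVec μ a c) = -flux t (fun μ => jVec μ c a) :=
    fun a c => by
      rw [flux, flux, ← integral_neg]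
      exact integral_congr_ae (.of_forall fun x => jVec_antisymm a.2.1 c.2.1 0 _)
  LinearMap.mk₂ ℝ (fun ζ η => flux t fun μ => jVec μ (ζ : Potential) (η : Potential))
    add_l smul_l
    (fun a b c => by rw [anti, add_l, neg_add, ← anti, ← anti])
    (fun r a c => by rw [anti, smul_l, ← smul_neg, ← anti])

lemma omegaMaxTilde_apply (t : ℝ) (ζ η : YMaxTilde) :
    omegaMaxTilde t ζ η = ∫ x : Fin 3 → ℝ, jMax 0 ζ η (spacetime t x) := rfl

lemma omegaVec_apply (t : ℝ) (ζ η : YVec) :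
    omegaVec t ζ η = ∫ x : Fin 3 → ℝ, jVec 0 ζ η (spacetime t x) := rfl

lemma omegaMaxTilde_isAlt (t : ℝ) : (omegaMaxTilde t).IsAlt := fun ζ => by
  have h : ∀ x, jMax 0 (ζ : Potential) ζ x = 0 := fun x => by
    have := jMax_antisymm ζ.2.1 ζ.2.1 0 x
    linarith
  simp [omegaMaxTilde_apply, h]

lemma omegaVec_isAlt (t : ℝ) : (omegaVec t).IsAlt := fun ζ => by
  have h : ∀ x, jVec 0 (ζ : Potential) ζ x = 0 := fun x => by
    have := jVec_antisymm ζ.2.1 ζ.2.1 0 x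
    linarith
  simp [omegaVec_apply, h]

/-! ### Symplectic reduction -/

section Reduction

variable {V : Type*} [AddCommGroup V] [Module ℝ V]

/-- The symplectic reduction `V / Ker B` of a presymplectic space `(V, B)`. -/
abbrev SymplecticReduction (B : LinearMap.BilinForm ℝ V) : Type _ := V ⧸ LinearMap.ker B

/-- The form induced by `B` on the symplectic reduction. -/
def reducedForm (B : LinearMap.BilinForm ℝ V) (hB : B.IsAlt) :
    LinearMap.BilinForm ℝ (SymplecticReduction B) :=
  (LinearMap.ker B).liftQ (((LinearMap.ker B).liftQ B le_rfl).flip) (by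
    intro w hw
    rw [LinearMap.mem_ker] at hw ⊢
    ext v
    have : B v w = 0 := by rw [← neg_neg (B v w), hB.neg_eq v w, hw]; simp
    simpa using this) |>.flip

lemma reducedForm_mk (B : LinearMap.BilinForm ℝ V) (hB : B.IsAlt) (v w : V) :
    reducedForm B hB (Submodule.Quotient.mk v) (Submodule.Quotient.mk w) = B v w := rfl

end Reduction

/-- `𝒴_Max = 𝒴_{Max~} / Ker ω_{Max~}`. -/
abbrev YMax (t : ℝ) : Type := SymplecticReduction (omegaMaxTilde t)

/-- The symplectic form `ω_Max` of `𝒴_Max`. -/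
def omegaMax (t : ℝ) : LinearMap.BilinForm ℝ (YMax t) :=
  reducedForm (omegaMaxTilde t) (omegaMaxTilde_isAlt t)

/-- The restriction of `ω_vec` to `𝒴_Lor`. -/
def omegaLor (t : ℝ) : LinearMap.BilinForm ℝ YLor :=
  (omegaVec t).compl₁₂ (Submodule.inclusion YLor_le_YVec) (Submodule.inclusion YLor_le_YVec)

lemma omegaLor_apply (t : ℝ) (ζ η : YLor) : omegaLor t ζ η
    = omegaVec t ⟨ζ, YLor_le_YVec ζ.2⟩ ⟨η, YLor_le_YVec η.2⟩ := rfl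

lemma omegaLor_isAlt (t : ℝ) : (omegaLor t).IsAlt := fun ζ =>
  omegaVec_isAlt t ⟨ζ, YLor_le_YVec ζ.2⟩

/-- The symplectic reduction `𝒴_Lor / (𝒴_Lor ∩ 𝒴_Lor^⊥)` of the subspace `𝒴_Lor` of `𝒴_vec`. -/
abbrev YLorRed (t : ℝ) : Type := SymplecticReduction (omegaLor t)

/-- The symplectic form of the symplectic reduction of `𝒴_Lor`. -/
def omegaLorRed (t : ℝ) : LinearMap.BilinForm ℝ (YLorRed t) :=
  reducedForm (omegaLor t) (omegaLor_isAlt t)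

end MaxwellFields

end

namespace MaxwellFields

/-! ### Differentiation under the integral for a finite measure carried by a compact set -/

section ParametricIntegral

/-! The Maxwell equation reads `□ζ_ν = ∂_ν(∂·ζ)`, so for divergence-free fields it coincides with
the wave equation. A Maxwell solution `ζ` becomes divergence-free after adding `∂χ` with `□χ =
-∂·ζ`, and `ζ + ∂χ` is then a wave solution. What has to be supplied is a smooth space-compact `χ`.

It is given by Kirchhoff's formula with zero Cauchy data at time zero: `u(x) = ∫₀^{x⁰} s M f(x,s)
ds`, where `M f(x,s)` is the mean of `f` over the sphere of radius `|s|` cut from the light cone of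
`x` at time `x⁰ - s`. The formula works for both signs of `x⁰`. That `□u = -f`
(`dAlembertian_wavePotential`) rests on `s M(□f)` being an exact derivative in `s`
(`hasDerivAt_coneBoundary`): the discrepancy is a spherical Laplacian, a sum of squares of rotation
fields, whose mean vanishes by rotation invariance (`integral_sphere_laplacian`). Since the cone
runs from `x` towards time zero, space-compactness is inherited (`spaceCompact_wavePotential`).

For the forms, two spatial divergences integrate to zero on a slice. On divergence-free fields the
two charge densities differ by `∂_i(ζ₀η_i - ζ_iη₀)` (`jMax_zero_eq`). The density of a Maxwell
solution against a gradient `∂χ` is the divergence of `χ` times the electric field, by Gauss's law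
(`jMax_zero_gradient`), so gauge directions lie in the kernel. Hence `YLor` meets every class modulo
`Ker ω`; the kernel of the restricted form is therefore the trace of `Ker ω`, and the quotients
agree. All this happens at one fixed `t`; conservation of the currents is not used. -/

lemma integrable_of_continuous_of_ae_mem_isCompact {Y G : Type*} [TopologicalSpace Y]
    [MeasurableSpace Y] [OpensMeasurableSpace Y] [SecondCountableTopology Y]
    [NormedAddCommGroup G] {ν : Measure Y} [IsFiniteMeasure ν] {S : Set Y}
    (hS : IsCompact S) (hν : ∀ᵐ w ∂ν, w ∈ S) {f : Y → G} (hf : Continuous f) :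
    Integrable f ν := by
  obtain ⟨C, hC⟩ := hS.exists_bound_of_continuousOn hf.continuousOn
  exact Integrable.of_bound hf.aestronglyMeasurable C (hν.mono fun w hw => hC w hw)

universe u v

variable {E : Type u} [NormedAddCommGroup E] [NormedSpace ℝ E] [FiniteDimensional ℝ E]
  {Y : Type v} [NormedAddCommGroup Y] [NormedSpace ℝ Y]
  [MeasurableSpace Y] [BorelSpace Y] [SecondCountableTopology Y]
  {ν : Measure Y} [IsFiniteMeasure ν] {S : Set Y}

/-- Domination is by a constant: the derivative is continuous, hence bounded on the compact product
of a closed ball around `p` with `S`. -/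
lemma hasFDerivAt_integral_of_contDiff {G : Type*} [NormedAddCommGroup G] [NormedSpace ℝ G]
    (hS : IsCompact S) (hν : ∀ᵐ w ∂ν, w ∈ S) {F : E × Y → G} (hF : ContDiff ℝ 1 F) (p : E) :
    HasFDerivAt (fun q => ∫ w, F (q, w) ∂ν)
      (∫ w, (fderiv ℝ F (p, w)).comp (ContinuousLinearMap.inl ℝ E Y) ∂ν) p := by
  have hd : Continuous fun z : E × Y =>
      (fderiv ℝ F z).comp (ContinuousLinearMap.inl ℝ E Y) :=
    (hF.continuous_fderiv one_ne_zero).clm_comp continuous_const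
  obtain ⟨C, hC⟩ := ((isCompact_closedBall p 1).prod hS).exists_bound_of_continuousOn
    hd.continuousOn
  refine hasFDerivAt_integral_of_dominated_of_fderiv_le
    (F' := fun q w => (fderiv ℝ F (q, w)).comp (ContinuousLinearMap.inl ℝ E Y))
    (bound := fun _ => C) (Metric.closedBall_mem_nhds p one_pos)
    (.of_forall fun q => ?_) ?_ ?_ ?_ (integrable_const C) ?_
  · exact (hF.continuous.comp (Continuous.prodMk_right q)).aestronglyMeasurable
  · exact integrable_of_continuous_of_ae_mem_isCompact hS hν
      (hF.continuous.comp (Continuous.prodMk_right p))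
  · exact (hd.comp (Continuous.prodMk_right p)).aestronglyMeasurable
  · exact hν.mono fun w hw q hq => hC (q, w) ⟨hq, hw⟩
  · refine .of_forall fun w q _ => ?_
    exact ((hF.differentiable one_ne_zero) (q, w)).hasFDerivAt.comp q
      (hasFDerivAt_prodMk_left q w)

/-- The derivative is again an integral of this kind, with values in `E →L[ℝ] G`, so induction on
`n` applies. `G` shares the universe of `E` so that this space may replace `G`. -/
lemma contDiff_integral_of_contDiff (hS : IsCompact S) (hν : ∀ᵐ w ∂ν, w ∈ S) :
    ∀ (n : ℕ) {G : Type u} [NormedAddCommGroup G] [NormedSpace ℝ G] {F : E × Y → G},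
      ContDiff ℝ ∞ F → ContDiff ℝ n fun q => ∫ w, F (q, w) ∂ν := by
  intro n
  induction n with
  | zero =>
    intro G _ _ F hF
    exact contDiff_zero.2 (continuous_iff_continuousAt.2 fun p =>
      (hasFDerivAt_integral_of_contDiff hS hν (hF.of_le (by simp)) p).continuousAt)
  | succ n ih =>
    intro G _ _ F hF
    have h1 := fun p => hasFDerivAt_integral_of_contDiff hS hν (hF.of_le (by simp)) p
    rw [Nat.cast_succ, contDiff_succ_iff_fderiv]
    refine ⟨fun p => (h1 p).differentiableAt, by simp, ?_⟩
    rw [funext fun p => (h1 p).fderiv]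
    exact ih (F := fun z => (fderiv ℝ F z).comp (ContinuousLinearMap.inl ℝ E Y))
      ((hF.fderiv_right (m := ∞) (by simp)).clm_comp contDiff_const)

lemma smooth_integral (hS : IsCompact S) (hν : ∀ᵐ w ∂ν, w ∈ S)
    {G : Type u} [NormedAddCommGroup G] [NormedSpace ℝ G] {F : E × Y → G}
    (hF : ContDiff ℝ ∞ F) : ContDiff ℝ ∞ fun q => ∫ w, F (q, w) ∂ν :=
  contDiff_infty.2 fun n => contDiff_integral_of_contDiff hS hν n hF

lemma fderiv_integral_apply {G : Type*} [NormedAddCommGroup G] [NormedSpace ℝ G] [CompleteSpace G]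
    (hS : IsCompact S) (hν : ∀ᵐ w ∂ν, w ∈ S) {F : E × Y → G} (hF : ContDiff ℝ 1 F) (p v : E) :
    fderiv ℝ (fun q => ∫ w, F (q, w) ∂ν) p v
      = ∫ w, fderiv ℝ (fun q => F (q, w)) p v ∂ν := by
  have hd : Continuous fun w : Y =>
      (fderiv ℝ F (p, w)).comp (ContinuousLinearMap.inl ℝ E Y) :=
    ((hF.continuous_fderiv one_ne_zero).comp (Continuous.prodMk_right p)).clm_comp
      continuous_const
  rw [(hasFDerivAt_integral_of_contDiff hS hν hF p).fderiv,
    ContinuousLinearMap.integral_apply (integrable_of_continuous_of_ae_mem_isCompact hS hν hd)]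
  refine integral_congr_ae (.of_forall fun w => ?_)
  have := ((hF.differentiable one_ne_zero) (p, w)).hasFDerivAt.comp p
    (hasFDerivAt_prodMk_left (𝕜 := ℝ) p w)
  exact congrArg (fun T => T v) this.fderiv.symm

lemma hasDerivAt_integral_of_contDiff {G : Type*} [NormedAddCommGroup G] [NormedSpace ℝ G]
    [CompleteSpace G] (hS : IsCompact S) (hν : ∀ᵐ w ∂ν, w ∈ S) {F : ℝ × Y → G}
    (hF : ContDiff ℝ 1 F) (s : ℝ) :
    HasDerivAt (fun r => ∫ w, F (r, w) ∂ν) (∫ w, deriv (fun r => F (r, w)) s ∂ν) s := by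
  have h := (hasFDerivAt_integral_of_contDiff hS hν hF s).differentiableAt.hasDerivAt
  rwa [← fderiv_apply_one_eq_deriv, fderiv_integral_apply hS hν hF] at h

end ParametricIntegral

end MaxwellFields

namespace MaxwellFields

open Matrix

/-! ### The uniform measure on the unit sphere -/

/-- The Euclidean length of a vector of `ℝ³`. -/
noncomputable def euclideanLength (y : Fin 3 → ℝ) : ℝ := Real.sqrt (y ⬝ᵥ y)

lemma zero_le_dotProduct_self (y : Fin 3 → ℝ) : 0 ≤ y ⬝ᵥ y :=
  Finset.sum_nonneg fun i _ => mul_self_nonneg (y i)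

lemma euclideanLength_sq (y : Fin 3 → ℝ) : euclideanLength y ^ 2 = y ⬝ᵥ y :=
  Real.sq_sqrt (zero_le_dotProduct_self y)

lemma continuous_euclideanLength : Continuous euclideanLength := by
  unfold euclideanLength dotProduct
  fun_prop

lemma abs_le_euclideanLength (y : Fin 3 → ℝ) (i : Fin 3) : |y i| ≤ euclideanLength y := by
  refine Real.le_sqrt_of_sq_le ?_
  rw [sq_abs, sq]
  exact Finset.single_le_sum (f := fun i => y i * y i) (fun i _ => mul_self_nonneg (y i))
    (Finset.mem_univ i)

/-- The Euclidean unit ball of `ℝ³`. -/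
def unitBall : Set (Fin 3 → ℝ) := {y | euclideanLength y ≤ 1}

lemma measurableSet_unitBall : MeasurableSet unitBall :=
  (isClosed_le continuous_euclideanLength continuous_const).measurableSet

lemma volume_unitBall_ne_zero : volume unitBall ≠ 0 := by
  refine fun h => ((isOpen_lt continuous_euclideanLength continuous_const).measure_pos
    volume ⟨0, ?_⟩).ne' (measure_mono_null (fun y (hy : euclideanLength y < 1) => hy.le) h)
  simp [euclideanLength]

lemma volume_unitBall_ne_top : volume unitBall ≠ ⊤ := by
  refine ((measure_mono (t := Metric.closedBall 0 1) fun y hy => ?_).trans_lt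
    (isCompact_closedBall _ _).measure_lt_top).ne
  rw [mem_closedBall_zero_iff, pi_norm_le_iff_of_nonneg zero_le_one]
  exact fun i => (abs_le_euclideanLength y i).trans hy

/-- The projection of `ℝ³ ∖ {0}` onto the unit sphere. -/
noncomputable def radialProjection (y : Fin 3 → ℝ) : Fin 3 → ℝ := (euclideanLength y)⁻¹ • y

lemma measurable_radialProjection : Measurable radialProjection :=
  continuous_euclideanLength.measurable.inv.smul measurable_id

/-- The rotation invariant probability measure on the unit sphere of `ℝ³`. -/
noncomputable def sphereMeasure : Measure (Fin 3 → ℝ) :=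
  ((volume unitBall)⁻¹ • volume.restrict unitBall).map radialProjection

instance : IsProbabilityMeasure sphereMeasure := by
  have : IsProbabilityMeasure ((volume unitBall)⁻¹ • volume.restrict unitBall) :=
    ⟨by simp [ENNReal.inv_mul_cancel volume_unitBall_ne_zero volume_unitBall_ne_top]⟩
  exact Measure.isProbabilityMeasure_map measurable_radialProjection.aemeasurable

lemma ae_sphereMeasure : ∀ᵐ w ∂sphereMeasure, w ⬝ᵥ w = 1 := by
  have hm : MeasurableSet {w : Fin 3 → ℝ | w ⬝ᵥ w = 1} :=
    (isClosed_eq (by unfold dotProduct; fun_prop) continuous_const).measurableSet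
  rw [sphereMeasure, ae_map_iff measurable_radialProjection.aemeasurable hm]
  refine Measure.ae_smul_measure (ae_restrict_of_ae ?_) _
  have h0 : ∀ᵐ y : Fin 3 → ℝ, y ≠ 0 := by
    rw [ae_iff]; simp
  filter_upwards [h0] with y hy
  have : y ⬝ᵥ y ≠ 0 := fun h => hy (dotProduct_self_eq_zero.1 h)
  rw [radialProjection, smul_dotProduct, dotProduct_smul, smul_smul, ← mul_inv, ← sq,
    euclideanLength_sq, smul_eq_mul, inv_mul_cancel₀ this]

lemma ae_sphereMeasure_mem_closedBall :
    ∀ᵐ w ∂sphereMeasure, w ∈ Metric.closedBall (0 : Fin 3 → ℝ) 1 := by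
  filter_upwards [ae_sphereMeasure] with w hw
  rw [mem_closedBall_zero_iff, pi_norm_le_iff_of_nonneg zero_le_one]
  refine fun i => (abs_le_euclideanLength w i).trans ?_
  rw [euclideanLength, hw, Real.sqrt_one]

/-- An orthogonal matrix has determinant `±1` and preserves length, so it preserves both Lebesgue
measure and the ball, and it commutes with the radial projection. -/
lemma map_mulVec_sphereMeasure {M : Matrix (Fin 3) (Fin 3) ℝ} (hM : Mᵀ * M = 1) :
    sphereMeasure.map (M *ᵥ ·) = sphereMeasure := by
  have hdet : M.det * M.det = 1 := by
    simpa [Matrix.det_mul] using congrArg Matrix.det hM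
  have hlen : ∀ y, euclideanLength (M *ᵥ y) = euclideanLength y := fun y => by
    rw [euclideanLength, euclideanLength, dotProduct_mulVec, vecMul_mulVec, hM, vecMul_one]
  have hmeas : Measurable fun y : Fin 3 → ℝ => M *ᵥ y :=
    (Continuous.matrix_mulVec continuous_const continuous_id).measurable
  have hvol : MeasurePreserving (fun y : Fin 3 → ℝ => M *ᵥ y) := by
    refine ⟨hmeas, ?_⟩
    have h0 : M.det ≠ 0 := fun h => by simp [h] at hdet
    have habs : |M.det⁻¹| = 1 := by
      rw [abs_inv, inv_eq_one, ← abs_one, ← sq_eq_sq_iff_abs_eq_abs, sq, hdet, one_pow]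
    have := Real.map_matrix_volume_pi_eq_smul_volume_pi h0
    rw [habs, ENNReal.ofReal_one, one_smul] at this
    exact this
  have hball : (fun y : Fin 3 → ℝ => M *ᵥ y) ⁻¹' unitBall = unitBall := by
    ext y; simp [unitBall, hlen]
  have hcomm : (M *ᵥ ·) ∘ radialProjection = radialProjection ∘ (M *ᵥ ·) := by
    funext y; simp [radialProjection, hlen, mulVec_smul]
  rw [sphereMeasure, Measure.map_map hmeas measurable_radialProjection, hcomm,
    ← Measure.map_map measurable_radialProjection hmeas, Measure.map_smul]
  congr 2
  have := (hvol.restrict_preimage measurableSet_unitBall).map_eq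
  rwa [hball] at this

/-- Rodrigues' formula: under `A³ = -A` the matrix is `exp(θA)`, orthogonal because `A` is skew. In
the product the odd powers cancel and `A⁴ = -A²`, leaving a multiple of `A²` whose coefficient is
zero. -/
lemma rodrigues_orthogonal {A : Matrix (Fin 3) (Fin 3) ℝ} (hA : Aᵀ = -A) (hA3 : A * A * A = -A)
    (θ : ℝ) : (1 + Real.sin θ • A + (1 - Real.cos θ) • (A * A))ᵀ
      * (1 + Real.sin θ • A + (1 - Real.cos θ) • (A * A)) = 1 := by
  have h3 : A * (A * A) = -A := by rw [← mul_assoc, hA3]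
  have hc : (1 - Real.cos θ) + (1 - Real.cos θ) - Real.sin θ ^ 2 - (1 - Real.cos θ) ^ 2 = 0 := by
    nlinarith [Real.sin_sq_add_cos_sq θ]
  have key : (1 + Real.sin θ • A + (1 - Real.cos θ) • (A * A))ᵀ
      * (1 + Real.sin θ • A + (1 - Real.cos θ) • (A * A)) = 1
      + ((1 - Real.cos θ) + (1 - Real.cos θ) - Real.sin θ ^ 2 - (1 - Real.cos θ) ^ 2)
        • (A * A) := by
    simp only [transpose_add, transpose_one, transpose_smul, hA, transpose_mul, neg_mul, mul_neg,
      neg_neg, add_mul, mul_add, one_mul, mul_one, smul_mul_assoc, mul_smul_comm, smul_neg, mul_assoc,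
      h3]
    module
  rw [key, hc, zero_smul, add_zero]

/-- The mean of `K ∘ exp(θA)` does not depend on `θ`; its derivative at `θ = 0` is the integral in
question. -/
lemma integral_fderiv_skew {A : Matrix (Fin 3) (Fin 3) ℝ} (hA : Aᵀ = -A) (hA3 : A * A * A = -A)
    {K : (Fin 3 → ℝ) → ℝ} (hK : ContDiff ℝ 1 K) :
    ∫ w, fderiv ℝ K w (A *ᵥ w) ∂sphereMeasure = 0 := by
  let R : ℝ × (Fin 3 → ℝ) → Fin 3 → ℝ := fun p =>
    p.2 + Real.sin p.1 • (A *ᵥ p.2) + (1 - Real.cos p.1) • ((A * A) *ᵥ p.2)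
  have hlin : ∀ B : Matrix (Fin 3) (Fin 3) ℝ, ContDiff ℝ 1 fun y : Fin 3 → ℝ => B *ᵥ y :=
    fun B => (B.mulVecLin.toContinuousLinearMap).contDiff
  have hR : ContDiff ℝ 1 R :=
    (contDiff_snd.add ((Real.contDiff_sin.comp contDiff_fst).smul ((hlin A).comp contDiff_snd))).add
      ((contDiff_const.sub (Real.contDiff_cos.comp contDiff_fst)).smul
        ((hlin (A * A)).comp contDiff_snd))
  have hconst : (fun θ : ℝ => ∫ w, K (R (θ, w)) ∂sphereMeasure)
      = fun _ => ∫ w, K w ∂sphereMeasure := by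
    funext θ
    have hRM : ∀ w, R (θ, w)
        = (1 + Real.sin θ • A + (1 - Real.cos θ) • (A * A)) *ᵥ w := fun w => by
      simp [R, add_mulVec, smul_mulVec]
    simp only [hRM]
    conv_rhs => rw [← map_mulVec_sphereMeasure (rodrigues_orthogonal hA hA3 θ)]
    exact (integral_map (hlin _).continuous.aemeasurable
      hK.continuous.aestronglyMeasurable).symm
  have hd := fderiv_integral_apply (isCompact_closedBall (0 : Fin 3 → ℝ) 1)
    ae_sphereMeasure_mem_closedBall (hK.comp hR) (0 : ℝ) 1
  simp only [Function.comp_apply] at hd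
  rw [hconst] at hd
  simp only [fderiv_fun_const, Pi.zero_apply, _root_.zero_apply] at hd
  rw [hd]
  refine integral_congr_ae (.of_forall fun w => ?_)
  have hR0 : R (0, w) = w := by simp [R]
  have hRd : HasDerivAt (fun θ => R (θ, w)) (A *ᵥ w) 0 := by
    have h1 := (((Real.hasDerivAt_sin 0).smul_const (A *ᵥ w)).const_add w).add
      (((Real.hasDerivAt_cos 0).const_sub 1).smul_const ((A * A) *ᵥ w))
    convert! h1 using 1
    simp
  have hKd := (hK.differentiable one_ne_zero (R (0, w))).hasFDerivAt.comp_hasDerivAt 0 hRd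
  have : HasDerivAt (fun θ => K (R (θ, w))) (fderiv ℝ K w (A *ᵥ w)) 0 := by rwa [hR0] at hKd
  exact this.deriv.symm

end MaxwellFields

namespace MaxwellFields

open Matrix

/-! ### Calculus of partial derivatives -/

lemma fderiv_eq_sum_pd (f : Minkowski → ℝ) (x v : Minkowski) :
    fderiv ℝ f x v = ∑ μ, v μ * pd μ f x := by
  conv_lhs => rw [← Finset.univ_sum_single v, map_sum]
  refine Finset.sum_congr rfl fun μ _ => ?_
  rw [show (Pi.single μ (v μ) : Minkowski) = v μ • Pi.single μ 1 by
    rw [← Pi.single_smul, smul_eq_mul, mul_one], map_smul, smul_eq_mul, pd]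

lemma pd_comm {f : Minkowski → ℝ} (hf : ContDiff ℝ ∞ f) (μ ν : Fin 4) (x : Minkowski) :
    pd μ (pd ν f) x = pd ν (pd μ f) x := by
  have hd : DifferentiableAt ℝ (fderiv ℝ f) x :=
    ((hf.fderiv_right (m := ∞) (by simp)).differentiable (by simp)) x
  have key : ∀ a b, pd a (pd b f) x = fderiv ℝ (fderiv ℝ f) x (Pi.single a 1) (Pi.single b 1) := by
    intro a b
    unfold pd
    rw [fderiv_clm_apply hd (differentiableAt_const _)]
    simp
  rw [key, key]
  exact ((contDiff_infty.1 hf 2).contDiffAt.isSymmSndFDerivAt (by simp)).eq _ _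

lemma pd_comp_add_right (f : Minkowski → ℝ) (c : Minkowski) (μ : Fin 4) (x : Minkowski) :
    pd μ (fun y => f (y + c)) x = pd μ f (x + c) := by
  rw [pd, fderiv_comp_add_right, pd]

lemma pd_const_mul {f : Minkowski → ℝ} (hf : Differentiable ℝ f) (c : ℝ) (μ : Fin 4)
    (x : Minkowski) : pd μ (fun y => c * f y) x = c * pd μ f x :=
  congrFun (pd_smul hf c μ) x

lemma dAlembertian_eq {f : Minkowski → ℝ} (hf : ContDiff ℝ ∞ f) (x : Minkowski) :
    dAlembertian f x = ∑ μ, sig μ * pd μ (pd μ f) x :=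
  Finset.sum_congr rfl fun μ _ => pd_const_mul (diff_of_smooth (smooth_pd hf μ)) _ _ _

lemma smooth_dAlembertian {f : Minkowski → ℝ} (hf : ContDiff ℝ ∞ f) :
    ContDiff ℝ ∞ (dAlembertian f) :=
  ContDiff.sum fun μ _ => smooth_pd (smooth_pdUp hf μ) μ

/-- In Kirchhoff's formula time enters twice, through the apex of the cone and through the upper
limit; this chain rule separates the two contributions. -/
lemma pd_comp_time {H : Minkowski × ℝ → ℝ} (hH : Differentiable ℝ H) (μ : Fin 4)
    (x : Minkowski) : pd μ (fun y => H (y, y 0)) x = pd μ (fun y => H (y, x 0)) x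
      + (Pi.single μ 1 : Minkowski) 0 * deriv (fun T => H (x, T)) (x 0) := by
  have h0 := (hH (x, x 0)).hasFDerivAt
  have h1 : HasFDerivAt (fun y : Minkowski => (y, y 0)) ((ContinuousLinearMap.id ℝ _).prod
      (ContinuousLinearMap.proj 0)) x :=
    (hasFDerivAt_id x).prodMk (hasFDerivAt_apply 0 x)
  have h2 := (h0.comp x (hasFDerivAt_prodMk_left (𝕜 := ℝ) x (x 0))).fderiv
  have h3 := (h0.comp_hasDerivAt (x 0) ((hasDerivAt_const (x 0) x).prodMk
    (hasDerivAt_id (x 0)))).deriv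
  have h4 := (h0.comp x h1).fderiv
  simp only [Function.comp_def] at h2 h3 h4
  rw [pd, pd, h2, h3, h4]
  simp only [ContinuousLinearMap.comp_apply, ContinuousLinearMap.prod_apply,
    ContinuousLinearMap.proj_apply, ContinuousLinearMap.id_apply, ContinuousLinearMap.inl_apply]
  rw [← smul_eq_mul, ← map_smul, ← map_add]
  simp

/-! ### Spherical means along the light cone -/

lemma spacetime_eq (t : ℝ) (w : Fin 3 → ℝ) :
    spacetime t w = spacetime t 0 + spacetime 0 w := by
  funext i
  refine Fin.cases ?_ (fun k => ?_) i <;> simp [spacetime]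

/-- The inclusion of space into space-time as the time zero slice. -/
noncomputable def spaceInclusion : (Fin 3 → ℝ) →L[ℝ] Minkowski :=
  ContinuousLinearMap.pi (Fin.cons 0 fun i => ContinuousLinearMap.proj i)

lemma spaceInclusion_apply (w : Fin 3 → ℝ) : spaceInclusion w = spacetime 0 w := by
  funext i
  refine Fin.cases ?_ (fun k => ?_) i <;> simp [spacetime, spaceInclusion]

lemma hasFDerivAt_spacetime (t : ℝ) (w : Fin 3 → ℝ) :
    HasFDerivAt (spacetime t) spaceInclusion w := by
  have : spacetime t = fun w => spacetime t 0 + spaceInclusion w := by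
    funext w; rw [spaceInclusion_apply, ← spacetime_eq]
  rw [this]
  exact spaceInclusion.hasFDerivAt.const_add _

lemma contDiff_spacetime (t : ℝ) : ContDiff ℝ ∞ (spacetime t) := by
  have : spacetime t = fun w => spacetime t 0 + spaceInclusion w := by
    funext w; rw [spaceInclusion_apply, ← spacetime_eq]
  rw [this]
  exact contDiff_const.add spaceInclusion.contDiff

lemma fderiv_comp_cone {h : Minkowski → ℝ} (hh : Differentiable ℝ h) (x : Minkowski) (s : ℝ)
    (w v : Fin 3 → ℝ) : fderiv ℝ (fun w => h (x + s • spacetime (-1) w)) w v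
      = s * ∑ j, v j * pd j.succ h (x + s • spacetime (-1) w) := by
  have h1 := ((hasFDerivAt_spacetime (-1) w).const_smul s).const_add x
  have h2 := ((hh (x + s • spacetime (-1) w)).hasFDerivAt.comp w h1).fderiv
  simp only [Function.comp_def, Pi.smul_apply] at h2
  rw [h2]
  simp only [ContinuousLinearMap.comp_apply, _root_.smul_apply, map_smul,
    spaceInclusion_apply, smul_eq_mul]
  rw [fderiv_eq_sum_pd, Fin.sum_univ_succ]
  simp [spacetime]

lemma deriv_comp_cone {h : Minkowski → ℝ} (hh : Differentiable ℝ h) (x : Minkowski) (s : ℝ)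
    (w : Fin 3 → ℝ) : HasDerivAt (fun r : ℝ => h (x + r • spacetime (-1) w))
      (-pd 0 h (x + s • spacetime (-1) w)
        + ∑ j, w j * pd j.succ h (x + s • spacetime (-1) w)) s := by
  have h1 := ((hasDerivAt_id s).smul_const (spacetime (-1) w)).const_add x
  have h2 := (hh (x + s • spacetime (-1) w)).hasFDerivAt.comp_hasDerivAt s h1
  rw [one_smul, fderiv_eq_sum_pd, Fin.sum_univ_succ] at h2
  convert! h2 using 1
  simp [spacetime]

lemma smooth_cone {h : Minkowski → ℝ} (hh : ContDiff ℝ ∞ h) :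
    ContDiff ℝ ∞ fun p : (Minkowski × ℝ) × (Fin 3 → ℝ) =>
      h (p.1.1 + p.1.2 • spacetime (-1) p.2) :=
  hh.comp ((contDiff_fst.comp contDiff_fst).add ((contDiff_snd.comp contDiff_fst).smul
    ((contDiff_spacetime (-1)).comp contDiff_snd)))

lemma smooth_cone_right {h : Minkowski → ℝ} (hh : ContDiff ℝ ∞ h) (x : Minkowski) :
    ContDiff ℝ ∞ fun p : ℝ × (Fin 3 → ℝ) => h (x + p.1 • spacetime (-1) p.2) :=
  (smooth_cone hh).comp ((contDiff_const.prodMk contDiff_fst).prodMk contDiff_snd)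

lemma smooth_cone_sphere {h : Minkowski → ℝ} (hh : ContDiff ℝ ∞ h) (x : Minkowski) (s : ℝ) :
    ContDiff ℝ ∞ fun w : Fin 3 → ℝ => h (x + s • spacetime (-1) w) :=
  (smooth_cone_right hh x).comp (contDiff_const.prodMk contDiff_id)

/-- The generators of the rotations of `ℝ³` about the coordinate axes. -/
noncomputable def rotationGenerator : Fin 3 → Matrix (Fin 3) (Fin 3) ℝ :=
  ![!![0, 0, 0; 0, 0, -1; 0, 1, 0], !![0, 0, 1; 0, 0, 0; -1, 0, 0],
    !![0, -1, 0; 1, 0, 0; 0, 0, 0]]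

lemma rotationGenerator_skew (k : Fin 3) : (rotationGenerator k)ᵀ = -rotationGenerator k := by
  ext i j
  fin_cases k <;> fin_cases i <;> fin_cases j <;> simp [rotationGenerator]

lemma rotationGenerator_cube (k : Fin 3) :
    rotationGenerator k * rotationGenerator k * rotationGenerator k = -rotationGenerator k := by
  ext i j
  fin_cases k <;> fin_cases i <;> fin_cases j <;>
    simp [rotationGenerator, Matrix.mul_apply, Fin.sum_univ_three]

/-- For `s ≠ 0` the integrand is `s⁻¹` times the spherical Laplacian of `w ↦ f (x + s(-1, w))`. That
Laplacian is the sum of the squares of the three rotation fields, and a rotational derivative has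
mean zero. -/
lemma integral_sphere_laplacian {f : Minkowski → ℝ} (hf : ContDiff ℝ ∞ f) (x : Minkowski)
    (s : ℝ) : ∫ w, (s * ∑ i : Fin 3, pd i.succ (pd i.succ f) (x + s • spacetime (-1) w)
      - s * ∑ i : Fin 3, ∑ j : Fin 3,
          w i * w j * pd j.succ (pd i.succ f) (x + s • spacetime (-1) w)
      - 2 * ∑ i : Fin 3, w i * pd i.succ f (x + s • spacetime (-1) w)) ∂sphereMeasure = 0 := by
  have hlin : ∀ (B : Matrix (Fin 3) (Fin 3) ℝ) i, ContDiff ℝ ∞ fun y : Fin 3 → ℝ => (B *ᵥ y) i :=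
    fun B i => contDiff_pi.1 (B.mulVecLin.toContinuousLinearMap).contDiff i
  -- The `k`-th rotational derivative of `f` on the sphere, with its factor `s` omitted, so that `s
  -- = 0` needs no separate treatment.
  let K : Fin 3 → (Fin 3 → ℝ) → ℝ := fun k w =>
    ∑ i, (rotationGenerator k *ᵥ w) i * pd i.succ f (x + s • spacetime (-1) w)
  have hK : ∀ k, ContDiff ℝ ∞ (K k) := fun k => ContDiff.sum fun i _ =>
    (hlin _ i).mul (smooth_cone_sphere (smooth_pd hf _) x s)
  have hKd : ∀ k w v, fderiv ℝ (K k) w v = ∑ i, ((rotationGenerator k *ᵥ w) i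
        * (s * ∑ j, v j * pd j.succ (pd i.succ f) (x + s • spacetime (-1) w))
      + pd i.succ f (x + s • spacetime (-1) w) * (rotationGenerator k *ᵥ v) i) := by
    intro k w v
    have hB : ∀ i, fderiv ℝ (fun y : Fin 3 → ℝ => (rotationGenerator k *ᵥ y) i) w v
        = (rotationGenerator k *ᵥ v) i := fun i => by
      have := ((ContinuousLinearMap.proj (R := ℝ) (φ := fun _ : Fin 3 => ℝ) i).comp
        (rotationGenerator k).mulVecLin.toContinuousLinearMap).hasFDerivAt (x := w)
      exact congrArg (fun T => T v) this.fderiv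
    simp only [K]
    rw [fderiv_fun_sum fun i _ => (((hlin _ i).mul
      (smooth_cone_sphere (smooth_pd hf _) x s)).differentiable (by simp)) w]
    rw [_root_.sum_apply]
    refine Finset.sum_congr rfl fun i _ => ?_
    rw [fderiv_fun_mul ((hlin _ i).differentiable (by simp) w)
      ((smooth_cone_sphere (smooth_pd hf _) x s).differentiable (by simp) w)]
    simp only [_root_.add_apply, _root_.smul_apply, smul_eq_mul,
      fderiv_comp_cone (diff_of_smooth (smooth_pd hf i.succ)), hB]
  have hint : ∀ k, Integrable (fun w => fderiv ℝ (K k) w (rotationGenerator k *ᵥ w))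
      sphereMeasure := fun k =>
    integrable_of_continuous_of_ae_mem_isCompact (isCompact_closedBall _ _)
      ae_sphereMeasure_mem_closedBall (((hK k).continuous_fderiv (by simp)).clm_apply
        (Continuous.matrix_mulVec continuous_const continuous_id))
  have hsum : ∫ w, ∑ k, fderiv ℝ (K k) w (rotationGenerator k *ᵥ w) ∂sphereMeasure = 0 := by
    rw [integral_finsetSum _ fun k _ => hint k]
    exact Finset.sum_eq_zero fun k _ => integral_fderiv_skew (rotationGenerator_skew k)
      (rotationGenerator_cube k) ((hK k).of_le (by simp))
  rw [← hsum]
  refine integral_congr_ae ?_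
  filter_upwards [ae_sphereMeasure] with w hw
  simp only [dotProduct, Fin.sum_univ_three] at hw
  have h0 : w 0 * w 0 = 1 - w 1 * w 1 - w 2 * w 2 := by linarith
  simp only [hKd, Fin.sum_univ_three, rotationGenerator, mulVec, dotProduct]
  simp
  ring_nf
  -- The two sides agree only on the unit sphere, hence the elimination of `w 0 ^ 2`.
  simp only [show w 0 ^ 2 = 1 - w 1 ^ 2 - w 2 ^ 2 by linarith]
  ring

end MaxwellFields

namespace MaxwellFields

open Matrix

/-- The mean of `f` over the sphere of radius `|s|` cut out at time `x⁰ - s` by the light cone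
of `x`. -/
noncomputable def coneMean (f : Minkowski → ℝ) (x : Minkowski) (s : ℝ) : ℝ :=
  ∫ w, f (x + s • spacetime (-1) w) ∂sphereMeasure

variable {f : Minkowski → ℝ}

lemma smooth_coneMean (hf : ContDiff ℝ ∞ f) :
    ContDiff ℝ ∞ fun p : Minkowski × ℝ => coneMean f p.1 p.2 :=
  smooth_integral (isCompact_closedBall _ _) ae_sphereMeasure_mem_closedBall (smooth_cone hf)

lemma integrable_sphere {F : (Fin 3 → ℝ) → ℝ} (hF : Continuous F) :
    Integrable F sphereMeasure :=
  integrable_of_continuous_of_ae_mem_isCompact (isCompact_closedBall _ _)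
    ae_sphereMeasure_mem_closedBall hF

lemma pd_coneMean (hf : ContDiff ℝ ∞ f) (μ : Fin 4) (x : Minkowski) (s : ℝ) :
    pd μ (fun y => coneMean f y s) x = coneMean (pd μ f) x s := by
  have h := fderiv_integral_apply (isCompact_closedBall _ _) ae_sphereMeasure_mem_closedBall
    (((smooth_cone hf).comp ((contDiff_fst.prodMk contDiff_const).prodMk contDiff_snd :
      ContDiff ℝ ∞ fun p : Minkowski × (Fin 3 → ℝ) => ((p.1, s), p.2))).of_le (by simp))
      x (Pi.single μ 1)
  refine h.trans (integral_congr_ae (.of_forall fun w => ?_))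
  exact pd_comp_add_right f (s • spacetime (-1) w) μ x

lemma hasDerivAt_coneMean (hf : ContDiff ℝ ∞ f) (x : Minkowski) (s : ℝ) :
    HasDerivAt (coneMean f x) (∫ w, (-pd 0 f (x + s • spacetime (-1) w)
      + ∑ j, w j * pd j.succ f (x + s • spacetime (-1) w)) ∂sphereMeasure) s := by
  have h := hasDerivAt_integral_of_contDiff (isCompact_closedBall _ _)
    ae_sphereMeasure_mem_closedBall ((smooth_cone_right hf x).of_le (by simp)) s
  simp only [(deriv_comp_cone (diff_of_smooth hf) x s _).deriv] at h
  exact h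

/-- The integrand of `coneBoundary`. -/
noncomputable def coneBoundaryIntegrand (f : Minkowski → ℝ) (x : Minkowski)
    (p : ℝ × (Fin 3 → ℝ)) : ℝ :=
  f (x + p.1 • spacetime (-1) p.2) + p.1 * (pd 0 f (x + p.1 • spacetime (-1) p.2)
    + ∑ i, p.2 i * pd i.succ f (x + p.1 • spacetime (-1) p.2))

/-- The primitive, along the light cone of `x`, of `s` times the mean of `□ f`. -/
noncomputable def coneBoundary (f : Minkowski → ℝ) (x : Minkowski) (s : ℝ) : ℝ :=
  ∫ w, coneBoundaryIntegrand f x (s, w) ∂sphereMeasure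

lemma smooth_coneBoundaryIntegrand (hf : ContDiff ℝ ∞ f) (x : Minkowski) :
    ContDiff ℝ ∞ (coneBoundaryIntegrand f x) :=
  (smooth_cone_right hf x).add (contDiff_fst.mul
    ((smooth_cone_right (smooth_pd hf 0) x).add (ContDiff.sum fun i _ =>
      (contDiff_pi.1 contDiff_snd i).mul (smooth_cone_right (smooth_pd hf _) x))))

lemma coneBoundary_zero (f : Minkowski → ℝ) (x : Minkowski) : coneBoundary f x 0 = f x := by
  simp [coneBoundary, coneBoundaryIntegrand]

/-- Along the ray the derivative is `-∂₀ + w·∇`. Applied to `f + s(∂₀ + w·∇)f` it yields `s(-∂₀² +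
(w·∇)²)f + 2 w·∇f`, which differs from `s □f` by the mean-zero expression of
`integral_sphere_laplacian`. -/
lemma hasDerivAt_coneBoundary (hf : ContDiff ℝ ∞ f) (x : Minkowski) (s : ℝ) :
    HasDerivAt (coneBoundary f x) (s * coneMean (dAlembertian f) x s) s := by
  have h := hasDerivAt_integral_of_contDiff (isCompact_closedBall _ _)
    ae_sphereMeasure_mem_closedBall
    ((smooth_coneBoundaryIntegrand hf x).of_le (by simp)) s
  have hd : ∀ w, HasDerivAt (fun r => coneBoundaryIntegrand f x (r, w))
      (s * dAlembertian f (x + s • spacetime (-1) w)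
        - (s * ∑ i : Fin 3, pd i.succ (pd i.succ f) (x + s • spacetime (-1) w)
      - s * ∑ i : Fin 3, ∑ j : Fin 3,
          w i * w j * pd j.succ (pd i.succ f) (x + s • spacetime (-1) w)
      - 2 * ∑ i : Fin 3, w i * pd i.succ f (x + s • spacetime (-1) w))) s := by
    intro w
    have hc := fun {h : Minkowski → ℝ} (hh : ContDiff ℝ ∞ h) =>
      deriv_comp_cone (diff_of_smooth hh) x s w
    have := (hc hf).add ((hasDerivAt_id s).mul ((hc (smooth_pd hf 0)).add
      (HasDerivAt.fun_sum (u := Finset.univ) fun i _ =>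
        (hc (smooth_pd hf (Fin.succ i))).const_mul (w i))))
    convert! this using 1
    rw [dAlembertian_eq hf]
    simp only [id, Pi.add_apply, Fin.sum_univ_four, Fin.sum_univ_three, pd_comm hf 0, sig]
    simp
    ring
  rw [integral_congr_ae (.of_forall fun w => (hd w).deriv)] at h
  have hcont := fun {h : Minkowski → ℝ} (hh : ContDiff ℝ ∞ h) =>
    (smooth_cone_sphere hh x s).continuous
  rw [integral_sub, integral_sphere_laplacian hf, sub_zero, integral_const_mul] at h
  · exact h
  · exact (integrable_sphere (hcont (smooth_dAlembertian hf))).const_mul s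
  · refine integrable_sphere (((continuous_const.mul (continuous_finsetSum _ fun i _ =>
      hcont (smooth_pd (smooth_pd hf _) _))).sub (continuous_const.mul
      (continuous_finsetSum _ fun i _ => continuous_finsetSum _ fun j _ =>
        ((continuous_apply i).mul (continuous_apply j)).mul
          (hcont (smooth_pd (smooth_pd hf _) _))))).sub (continuous_const.mul
      (continuous_finsetSum _ fun i _ => (continuous_apply i).mul (hcont (smooth_pd hf _)))))

/-! ### The wave equation with vanishing Cauchy data -/

/-- The integral of `f` over the part of the light cone of `x` of height at most `T`. -/
noncomputable def conePotential (f : Minkowski → ℝ) (x : Minkowski) (T : ℝ) : ℝ :=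
  ∫ s in (0 : ℝ)..T, s * coneMean f x s

/-- The solution of `□ u = -f` with vanishing Cauchy data at time zero. -/
noncomputable def wavePotential (f : Minkowski → ℝ) (x : Minkowski) : ℝ :=
  conePotential f x (x 0)

/-- The substitution `s = T r` moves `T` from the limit into the integrand, so smoothness in `(x,
T)` follows from the theorem on parametric integrals, for either sign of `T`. -/
lemma conePotential_eq (f : Minkowski → ℝ) (x : Minkowski) (T : ℝ) :
    conePotential f x T
      = ∫ r in Ioc (0 : ℝ) 1, T * (T * r * coneMean f x (T * r)) := by
  rw [← intervalIntegral.integral_of_le zero_le_one, intervalIntegral.integral_const_mul,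
    intervalIntegral.mul_integral_comp_mul_left (f := fun s => s * coneMean f x s)]
  simp [conePotential]

lemma smooth_conePotential_integrand (hf : ContDiff ℝ ∞ f) :
    ContDiff ℝ ∞ fun p : (Minkowski × ℝ) × ℝ =>
      p.1.2 * (p.1.2 * p.2 * coneMean f p.1.1 (p.1.2 * p.2)) := by
  have hT : ContDiff ℝ ∞ fun p : (Minkowski × ℝ) × ℝ => p.1.2 := contDiff_snd.comp contDiff_fst
  exact hT.mul ((hT.mul contDiff_snd).mul ((smooth_coneMean hf).comp
    ((contDiff_fst.comp contDiff_fst).prodMk (hT.mul contDiff_snd))))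

lemma ae_Ioc_mem_Icc (a b : ℝ) : ∀ᵐ r ∂(volume.restrict (Ioc a b)), r ∈ Icc a b :=
  (ae_restrict_mem measurableSet_Ioc).mono fun _ h => Ioc_subset_Icc_self h

lemma smooth_conePotential (hf : ContDiff ℝ ∞ f) :
    ContDiff ℝ ∞ fun p : Minkowski × ℝ => conePotential f p.1 p.2 := by
  simp only [conePotential_eq]
  exact smooth_integral isCompact_Icc (ae_Ioc_mem_Icc 0 1) (smooth_conePotential_integrand hf)

lemma smooth_wavePotential (hf : ContDiff ℝ ∞ f) : ContDiff ℝ ∞ (wavePotential f) :=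
  (smooth_conePotential hf).comp (contDiff_id.prodMk (contDiff_apply ℝ ℝ 0))

lemma smooth_coneMean_left (hf : ContDiff ℝ ∞ f) (s : ℝ) :
    ContDiff ℝ ∞ fun x => coneMean f x s :=
  (smooth_coneMean hf).comp (contDiff_id.prodMk contDiff_const)

lemma pd_conePotential (hf : ContDiff ℝ ∞ f) (μ : Fin 4) (x : Minkowski) (T : ℝ) :
    pd μ (fun y => conePotential f y T) x = conePotential (pd μ f) x T := by
  simp only [conePotential_eq]
  have h := fderiv_integral_apply isCompact_Icc (ae_Ioc_mem_Icc 0 1)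
    (((smooth_conePotential_integrand hf).comp ((contDiff_fst.prodMk contDiff_const).prodMk
      contDiff_snd : ContDiff ℝ ∞ fun p : Minkowski × ℝ => ((p.1, T), p.2))).of_le (by simp))
      x (Pi.single μ 1)
  refine h.trans (integral_congr_ae (.of_forall fun r => ?_))
  have hm := diff_of_smooth (smooth_coneMean_left hf (T * r))
  have : pd μ (fun y => T * (T * r * coneMean f y (T * r))) x
      = T * (T * r * coneMean (pd μ f) x (T * r)) := by
    rw [pd_const_mul (hm.const_mul _), pd_const_mul hm, pd_coneMean hf]
  exact this

lemma continuous_mul_coneMean (hf : ContDiff ℝ ∞ f) (x : Minkowski) :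
    Continuous fun s => s * coneMean f x s :=
  continuous_id.mul ((smooth_coneMean hf).continuous.comp (Continuous.prodMk_right x))

lemma deriv_conePotential (hf : ContDiff ℝ ∞ f) (x : Minkowski) (T : ℝ) :
    deriv (conePotential f x) T = T * coneMean f x T :=
  (continuous_mul_coneMean hf x).deriv_integral _ 0 T

/-- The time derivative coming from the upper limit of the integral in `wavePotential`. -/
noncomputable def sliceMean (f : Minkowski → ℝ) (x : Minkowski) : ℝ := x 0 * coneMean f x (x 0)

lemma smooth_mul_coneMean (hf : ContDiff ℝ ∞ f) :
    ContDiff ℝ ∞ fun p : Minkowski × ℝ => p.2 * coneMean f p.1 p.2 :=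
  contDiff_snd.mul (smooth_coneMean hf)

lemma pd_wavePotential (hf : ContDiff ℝ ∞ f) (μ : Fin 4) (x : Minkowski) :
    pd μ (wavePotential f) x = wavePotential (pd μ f) x
      + (Pi.single μ 1 : Minkowski) 0 * sliceMean f x := by
  refine (pd_comp_time ((smooth_conePotential hf).differentiable (by simp)) μ x).trans ?_
  rw [pd_conePotential hf]
  congr 2
  exact deriv_conePotential hf x (x 0)

lemma smooth_sliceMean (hf : ContDiff ℝ ∞ f) : ContDiff ℝ ∞ (sliceMean f) :=
  (smooth_mul_coneMean hf).comp (contDiff_id.prodMk (contDiff_apply ℝ ℝ 0))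

lemma pd_zero_sliceMean (hf : ContDiff ℝ ∞ f) (x : Minkowski) :
    pd 0 (sliceMean f) x = sliceMean (pd 0 f) x + deriv (fun T => T * coneMean f x T) (x 0) := by
  refine (pd_comp_time ((smooth_mul_coneMean hf).differentiable (by simp)) 0 x).trans ?_
  rw [pd_const_mul (diff_of_smooth (smooth_coneMean_left hf _)), pd_coneMean hf]
  simp [sliceMean]

/-- The right-hand side is what two time derivatives of `wavePotential` produce from the upper
limit. The ray derivative carries `-∂₀` where the boundary term has `+∂₀`, hence the factor `2`. -/
lemma coneBoundary_eq (hf : ContDiff ℝ ∞ f) (x : Minkowski) (T : ℝ) :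
    coneBoundary f x T = 2 * (T * coneMean (pd 0 f) x T)
      + deriv (fun T => T * coneMean f x T) T := by
  have hcont := fun {h : Minkowski → ℝ} (hh : ContDiff ℝ ∞ h) =>
    (smooth_cone_sphere hh x T).continuous
  have hd := ((hasDerivAt_id T).mul (hasDerivAt_coneMean hf x T)).deriv
  have hi : Continuous fun w : Fin 3 → ℝ => -pd 0 f (x + T • spacetime (-1) w)
      + ∑ j, w j * pd j.succ f (x + T • spacetime (-1) w) :=
    (hcont (smooth_pd hf 0)).neg.add (continuous_finsetSum _ fun i _ =>
      (continuous_apply i).mul (hcont (smooth_pd hf _)))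
  change deriv (fun T => T * coneMean f x T) T = _ at hd
  rw [hd, id, one_mul, coneMean, coneMean, ← integral_const_mul, ← integral_const_mul,
    ← integral_const_mul, ← integral_add (integrable_sphere (hcont hf))
      ((integrable_sphere hi).const_mul T), ← integral_add]
  · refine integral_congr_ae (.of_forall fun w => ?_)
    simp only [coneBoundaryIntegrand]
    ring
  · exact ((integrable_sphere (hcont (smooth_pd hf 0))).const_mul _).const_mul _
  · exact (integrable_sphere (hcont hf)).add ((integrable_sphere hi).const_mul T)

lemma wavePotential_const_mul (f : Minkowski → ℝ) (c : ℝ) (x : Minkowski) :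
    wavePotential (fun y => c * f y) x = c * wavePotential f x := by
  simp only [wavePotential, conePotential, coneMean, integral_const_mul, mul_left_comm _ c,
    intervalIntegral.integral_const_mul]

lemma wavePotential_sum {ι : Type*} (s : Finset ι) {g : ι → Minkowski → ℝ}
    (hg : ∀ i ∈ s, ContDiff ℝ ∞ (g i)) (x : Minkowski) :
    wavePotential (fun y => ∑ i ∈ s, g i y) x = ∑ i ∈ s, wavePotential (g i) x := by
  simp only [wavePotential, conePotential]
  rw [← intervalIntegral.integral_finsetSum fun i hi =>
    (continuous_mul_coneMean (hg i hi) x).intervalIntegrable _ _]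
  congr 1
  funext r
  rw [← Finset.mul_sum]
  simp only [coneMean]
  rw [integral_finsetSum _ fun i hi => integrable_sphere (smooth_cone_sphere (hg i hi) x r).continuous]

/-- Moving `□` under the integral gives `coneBoundary` at `x⁰` minus its value `f x` at `0`. The
terms from the upper limit, which carry the sign of `-∂₀²`, cancel the former. -/
theorem dAlembertian_wavePotential (hf : ContDiff ℝ ∞ f) (x : Minkowski) :
    dAlembertian (wavePotential f) x = -f x := by
  have h1 : ∀ μ, pd μ (wavePotential f) = wavePotential (pd μ f)
      + (Pi.single μ 1 : Minkowski) 0 • sliceMean f := fun μ => funext (pd_wavePotential hf μ)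
  have h2 : ∀ μ, pd μ (pd μ (wavePotential f)) x = wavePotential (pd μ (pd μ f)) x
      + (Pi.single μ 1 : Minkowski) 0 * (sliceMean (pd μ f) x + pd μ (sliceMean f) x) := by
    intro μ
    rw [h1, pd_add (diff_of_smooth (smooth_wavePotential (smooth_pd hf μ)))
      ((diff_of_smooth (smooth_sliceMean hf)).const_smul _),
      pd_smul (diff_of_smooth (smooth_sliceMean hf)), Pi.add_apply,
      pd_wavePotential (smooth_pd hf μ)]
    simp only [Pi.smul_apply, smul_eq_mul]
    ring
  have h3 : wavePotential (dAlembertian f) x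
      = ∑ μ, sig μ * wavePotential (pd μ (pd μ f)) x := by
    rw [funext (dAlembertian_eq hf), wavePotential_sum _ fun μ _ =>
      contDiff_const.mul (smooth_pd (smooth_pd hf μ) μ)]
    exact Finset.sum_congr rfl fun μ _ => wavePotential_const_mul _ _ _
  have h4 : wavePotential (dAlembertian f) x = coneBoundary f x (x 0) - f x := by
    rw [← coneBoundary_zero f x]
    exact intervalIntegral.integral_eq_sub_of_hasDerivAt
      (fun s _ => hasDerivAt_coneBoundary hf x s)
      ((continuous_mul_coneMean (smooth_dAlembertian hf) x).intervalIntegrable _ _)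
  rw [dAlembertian_eq (smooth_wavePotential hf)]
  have h5 := coneBoundary_eq hf x (x 0)
  have h6 := pd_zero_sliceMean hf x
  simp only [sliceMean] at h6
  rw [h4, Fin.sum_univ_four] at h3
  rw [Fin.sum_univ_four, h2, h2, h2, h2]
  simp [sig, sliceMean] at h3 h6 ⊢
  linarith

end MaxwellFields

namespace MaxwellFields

open Matrix

/-! ### Space-compact supports -/

/-- The Euclidean length of the spatial part of `x`. -/
noncomputable def spatialNorm (x : Minkowski) : ℝ := euclideanLength (Fin.tail x)

lemma euclideanLength_eq_norm (y : Fin 3 → ℝ) : euclideanLength y = ‖WithLp.toLp 2 y‖ := by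
  rw [EuclideanSpace.norm_eq, euclideanLength]
  congr 1
  exact Finset.sum_congr rfl fun i _ => by simp [sq]

lemma spatialNorm_nonneg (x : Minkowski) : 0 ≤ spatialNorm x := Real.sqrt_nonneg _

lemma spatialNorm_add_le (x y : Minkowski) :
    spatialNorm (x + y) ≤ spatialNorm x + spatialNorm y := by
  simp only [spatialNorm, euclideanLength_eq_norm]
  exact norm_add_le (WithLp.toLp 2 (Fin.tail x)) (WithLp.toLp 2 (Fin.tail y))

lemma spatialNorm_smul (c : ℝ) (x : Minkowski) :
    spatialNorm (c • x) = |c| * spatialNorm x := by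
  simp only [spatialNorm, euclideanLength_eq_norm]
  exact norm_smul c (WithLp.toLp 2 (Fin.tail x))

lemma continuous_spatialNorm : Continuous spatialNorm :=
  continuous_euclideanLength.comp (continuous_pi fun i => continuous_apply i.succ)

lemma minkowskiSq_eq (x : Minkowski) : minkowskiSq x = spatialNorm x ^ 2 - x 0 ^ 2 := by
  rw [spatialNorm, euclideanLength_sq, minkowskiSq]
  simp [dotProduct, Fin.sum_univ_succ, sig, Fin.tail]
  ring

lemma mem_causalCone {x : Minkowski} : x ∈ causalCone ↔ x ≠ 0 ∧ spatialNorm x ≤ |x 0| := by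
  rw [causalCone, mem_ofPred_eq, minkowskiSq_eq, sub_nonpos, sq_le_sq,
    abs_of_nonneg (spatialNorm_nonneg x)]

/-- Replaces causal shadows by one inequality that is easy to propagate along cones. -/
theorem spaceCompact_iff {E : Type*} [Zero E] {f : Minkowski → E} :
    SpaceCompact f ↔ ∃ R, ∀ x, f x ≠ 0 → spatialNorm x ≤ R + |x 0| := by
  constructor
  · rintro ⟨K, hK, hs⟩
    obtain ⟨C, hC⟩ := hK.exists_bound_of_continuousOn (f := fun k => spatialNorm k + |k 0|)
      (continuous_spatialNorm.add (continuous_apply 0).abs).continuousOn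
    refine ⟨C, fun x hx => ?_⟩
    obtain ⟨k, hk, c, hc, rfl⟩ := hs (subset_tsupport _ hx)
    have h1 := (le_abs_self _).trans (hC k hk)
    have h2 := spatialNorm_add_le k c
    have h3 := (mem_causalCone.1 hc).2
    have h4 : |c 0| ≤ |k 0 + c 0| + |k 0| := by
      simpa [add_comm] using abs_sub (k 0 + c 0) (k 0)
    change spatialNorm (k + c) ≤ C + |k 0 + c 0|
    linarith
  · rintro ⟨R', hR'⟩
    obtain ⟨R, hR1, hR⟩ : ∃ R, 1 ≤ R ∧ R' ≤ R := ⟨max 1 R', le_max_left _ _, le_max_right _ _⟩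
    refine ⟨Metric.closedBall 0 R, isCompact_closedBall _ _, ?_⟩
    have hcl : tsupport f ⊆ {x | spatialNorm x ≤ R + |x 0|} :=
      closure_minimal (fun x hx => (hR' x hx).trans (by gcongr))
        (isClosed_le continuous_spatialNorm (continuous_const.add (continuous_apply 0).abs))
    intro x hx
    have hx' : spatialNorm x ≤ R + |x 0| := hcl hx
    have hρ : 0 < R + |x 0| := by positivity
    -- The causal cone omits the origin; a unit time shift away from zero makes the causal summand
    -- nonzero. The condition `1 ≤ R` leaves room for it in the ball.
    obtain ⟨e, he, hex⟩ : ∃ e : ℝ, |e| = 1 ∧ |x 0 + e| = |x 0| + 1 := by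
      rcases le_total 0 (x 0) with h | h
      · exact ⟨1, abs_one, by rw [abs_of_nonneg h, abs_of_nonneg (by linarith)]⟩
      · exact ⟨-1, by simp, by rw [abs_of_nonpos h, abs_of_nonpos (by linarith)]; ring⟩
    -- The spatial part is split in the ratio `R : |x 0|`, so that the summands have lengths at most
    -- `R` and `|x 0|`.
    let s := R / (R + |x 0|)
    have hs0 : 0 ≤ s := by positivity
    have hs1 : 1 - s = |x 0| / (R + |x 0|) := by
      simp only [s]; field_simp; ring
    have hs1' : 0 ≤ 1 - s := by rw [hs1]; positivity
    let k : Minkowski := Fin.cons (-e) (s • Fin.tail x)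
    let c : Minkowski := Fin.cons (x 0 + e) ((1 - s) • Fin.tail x)
    have hlen : ∀ a : ℝ, 0 ≤ a → euclideanLength (a • Fin.tail x) = a * spatialNorm x := by
      intro a ha
      have := spatialNorm_smul a x
      rwa [abs_of_nonneg ha] at this
    have hkn : euclideanLength (s • Fin.tail x) ≤ R := by
      rw [hlen s hs0]
      calc s * spatialNorm x ≤ s * (R + |x 0|) := by gcongr
        _ = R := by simp only [s]; field_simp
    have hcn : euclideanLength ((1 - s) • Fin.tail x) ≤ |x 0| := by
      rw [hlen _ hs1']
      calc (1 - s) * spatialNorm x ≤ (1 - s) * (R + |x 0|) := by gcongr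
        _ = |x 0| := by rw [hs1]; field_simp
    refine ⟨k, ?_, c, mem_causalCone.2 ⟨fun h => ?_, ?_⟩, ?_⟩
    · rw [mem_closedBall_zero_iff, pi_norm_le_iff_of_nonneg (by linarith)]
      intro i
      refine Fin.cases ?_ (fun j => ?_) i
      · simp only [k, Fin.cons_zero, norm_neg, Real.norm_eq_abs, he, hR1]
      · simp only [k, Fin.cons_succ, Real.norm_eq_abs]
        exact (abs_le_euclideanLength _ j).trans hkn
    · have h0 : x 0 + e = 0 := congrFun h 0
      rw [h0, abs_zero] at hex
      linarith [abs_nonneg (x 0)]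
    · simp only [spatialNorm, c, Fin.tail_cons, Fin.cons_zero, hex]
      linarith
    · funext i
      refine Fin.cases ?_ (fun j => ?_) i
      · simp [k, c]
      · simp [k, c, Fin.tail]; ring

lemma SpaceCompact.mono {E F : Type*} [Zero E] [Zero F] {f : Minkowski → E} {g : Minkowski → F}
    (hf : SpaceCompact f) (h : tsupport g ⊆ tsupport f) : SpaceCompact g := by
  obtain ⟨K, hK, hs⟩ := hf
  exact ⟨K, hK, h.trans hs⟩

lemma spatialNorm_smul_null {w : Fin 3 → ℝ} (hw : w ⬝ᵥ w = 1) (s : ℝ) :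
    spatialNorm (s • spacetime (-1) w) = |s| := by
  have : spatialNorm (spacetime (-1) w) = 1 := by
    simp [spatialNorm, spacetime, euclideanLength, hw]
  rw [spatialNorm_smul, this, mul_one]

lemma spaceCompact_wavePotential {f : Minkowski → ℝ} (hf : SpaceCompact f) :
    SpaceCompact (wavePotential f) := by
  obtain ⟨R, hR⟩ := spaceCompact_iff.1 hf
  refine spaceCompact_iff.2 ⟨R, fun x hx => ?_⟩
  contrapose! hx
  refine (intervalIntegral.integral_congr (g := fun _ => (0 : ℝ)) fun s hs => ?_).trans
    intervalIntegral.integral_zero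
  -- For `s` between `0` and `x 0`, what the cone gains in radius it loses in time, so the same `R`
  -- serves.
  have hs' : |x 0 - s| + |s| = |x 0| := by
    rcases le_total 0 (x 0) with h | h
    · rw [uIcc_of_le h] at hs
      rw [abs_of_nonneg h, abs_of_nonneg hs.1, abs_of_nonneg (sub_nonneg.2 hs.2)]; ring
    · rw [uIcc_of_ge h] at hs
      rw [abs_of_nonpos h, abs_of_nonpos hs.2, abs_of_nonpos (sub_nonpos.2 hs.1)]; ring
  suffices coneMean f x s = 0 by simp [this]
  refine integral_eq_zero_of_ae ?_
  filter_upwards [ae_sphereMeasure] with w hw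
  by_contra hne
  have h1 := hR _ hne
  have h0 : (x + s • spacetime (-1) w) 0 = x 0 - s := by simp [spacetime]; ring
  rw [h0] at h1
  have h2 := spatialNorm_add_le (x + s • spacetime (-1) w) ((-s) • spacetime (-1) w)
  rw [spatialNorm_smul_null hw, neg_smul, add_neg_cancel_right, abs_neg] at h2
  linarith

end MaxwellFields

namespace MaxwellFields

/-! ### The Lorentz gauge -/

lemma pd_up {ζ : Potential} (hζ : ContDiff ℝ ∞ ζ) (μ ν : Fin 4) :
    pd μ (up ζ ν) = sig ν • pd μ (low ζ ν) := by
  rw [up_eq, pd_smul (diff_of_smooth (smooth_low hζ ν))]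

lemma pdUp_up {ζ : Potential} (hζ : ContDiff ℝ ∞ ζ) (μ ν : Fin 4) :
    pdUp μ (up ζ ν) = (sig μ * sig ν) • pd μ (low ζ ν) := by
  rw [pdUp_eq, pd_up hζ, smul_smul]

lemma pd_sub {f g : Minkowski → ℝ} (hf : Differentiable ℝ f) (hg : Differentiable ℝ g)
    (μ : Fin 4) : pd μ (f - g) = pd μ f - pd μ g := by
  funext x
  simp [pd, fderiv_sub (hf x) (hg x)]

lemma pd_sum {ι : Type*} (s : Finset ι) {g : ι → Minkowski → ℝ}
    (hg : ∀ i ∈ s, Differentiable ℝ (g i)) (μ : Fin 4) (x : Minkowski) :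
    pd μ (fun y => ∑ i ∈ s, g i y) x = ∑ i ∈ s, pd μ (g i) x := by
  simp only [pd]
  rw [fderiv_fun_sum fun i hi => hg i hi x, _root_.sum_apply]

lemma pd_mul {f g : Minkowski → ℝ} (hf : Differentiable ℝ f) (hg : Differentiable ℝ g)
    (μ : Fin 4) (x : Minkowski) :
    pd μ (fun y => f y * g y) x = f x * pd μ g x + g x * pd μ f x := by
  rw [pd, fderiv_fun_mul (hf x) (hg x)]
  simp [pd]

lemma divergence_eq {ζ : Potential} (hζ : ContDiff ℝ ∞ ζ) (x : Minkowski) :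
    divergence ζ x = ∑ μ, sig μ * pd μ (low ζ μ) x :=
  Finset.sum_congr rfl fun μ _ => congrFun (pd_up hζ μ μ) x

lemma smooth_divergence {ζ : Potential} (hζ : ContDiff ℝ ∞ ζ) :
    ContDiff ℝ ∞ (divergence ζ) :=
  ContDiff.sum fun μ _ => smooth_pd (smooth_up hζ μ) μ

lemma pd_divergence {ζ : Potential} (hζ : ContDiff ℝ ∞ ζ) (ν : Fin 4) (x : Minkowski) :
    pd ν (divergence ζ) x = ∑ μ, sig μ * pd μ (pd ν (low ζ μ)) x := by
  rw [funext (divergence_eq hζ), pd_sum _ fun μ _ =>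
    (diff_of_smooth (smooth_pd (smooth_low hζ μ) μ)).const_mul _]
  refine Finset.sum_congr rfl fun μ _ => ?_
  rw [pd_const_mul (diff_of_smooth (smooth_pd (smooth_low hζ μ) μ)), pd_comm (smooth_low hζ μ)]

lemma maxwellOp_eq {ζ : Potential} (hζ : ContDiff ℝ ∞ ζ) (ν : Fin 4) (x : Minkowski) :
    maxwellOp ζ ν x = sig ν * (dAlembertian (low ζ ν) x - pd ν (divergence ζ) x) := by
  rw [dAlembertian_eq (smooth_low hζ ν), pd_divergence hζ, ← Finset.sum_sub_distrib,
    Finset.mul_sum]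
  refine Finset.sum_congr rfl fun μ _ => ?_
  have hd := fun a b => diff_of_smooth (smooth_pd (smooth_low hζ a) b)
  rw [pdUp_up hζ, pdUp_up hζ, pd_sub ((hd _ _).const_smul _) ((hd _ _).const_smul _),
    pd_smul (hd _ _), pd_smul (hd _ _)]
  simp only [Pi.sub_apply, Pi.smul_apply, smul_eq_mul]
  ring

lemma sig_mul_self (μ : Fin 4) : sig μ * sig μ = 1 := by
  fin_cases μ <;> simp [sig]

lemma sig_ne_zero (μ : Fin 4) : sig μ ≠ 0 := fun h => by simpa [h] using sig_mul_self μ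

lemma maxwell_iff {ζ : Potential} (hζ : ContDiff ℝ ∞ ζ) (ν : Fin 4) (x : Minkowski) :
    -maxwellOp ζ ν x = 0 ↔ dAlembertian (low ζ ν) x = pd ν (divergence ζ) x := by
  rw [maxwellOp_eq hζ, neg_eq_zero, mul_eq_zero, or_iff_right (sig_ne_zero ν), sub_eq_zero]

lemma YLor_le_YMaxTilde : YLor ≤ YMaxTilde := by
  rintro ζ ⟨⟨hζ, hw⟩, hdiv⟩
  refine ⟨hζ, fun ν x => (maxwell_iff hζ.1 ν x).2 ?_⟩
  rw [neg_eq_zero.1 (hw ν x), show divergence ζ = 0 from funext hdiv, pd_zero]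
  rfl

/-- The gradient of a function, as a vector field. -/
noncomputable def gradient (χ : Minkowski → ℝ) : Potential := fun x μ => pd μ χ x

lemma smooth_gradient {χ : Minkowski → ℝ} (hχ : ContDiff ℝ ∞ χ) : ContDiff ℝ ∞ (gradient χ) :=
  contDiff_pi.2 fun μ => smooth_pd hχ μ

lemma low_gradient (χ : Minkowski → ℝ) (μ : Fin 4) : low (gradient χ) μ = pd μ χ := rfl

lemma gradient_mem_smoothSC {χ : Minkowski → ℝ} (hχ : ContDiff ℝ ∞ χ) (hs : SpaceCompact χ) :
    gradient χ ∈ smoothSC := by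
  refine ⟨smooth_gradient hχ, hs.mono ?_⟩
  refine (closure_mono fun x hx => ?_).trans (tsupport_fderiv_subset ℝ (f := χ))
  refine fun h : fderiv ℝ χ x = 0 => hx (funext fun μ => ?_)
  rw [gradient, pd, h]
  rfl

/-- The topological support is needed: vanishing at the point alone says nothing about derivatives.
-/
lemma pd_low_eq_zero {ζ : Potential} {x : Minkowski} (hx : x ∉ tsupport ζ) (μ ν : Fin 4) :
    pd μ (low ζ ν) x = 0 := by
  have h1 : low ζ ν =ᶠ[nhds x] 0 := by
    filter_upwards [notMem_tsupport_iff_eventuallyEq.1 hx] with y hy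
    simp [low, hy]
  rw [pd, h1.fderiv_eq]
  simp

lemma SpaceCompact.of_eq_zero {E F : Type*} [Zero E] [Zero F] {f : Minkowski → E}
    {g : Minkowski → F} (hf : SpaceCompact f) (h : ∀ x ∉ tsupport f, g x = 0) :
    SpaceCompact g :=
  hf.mono (closure_minimal (fun x hx => by_contra fun hn => hx (h x hn)) (isClosed_tsupport _))

lemma spaceCompact_divergence {ζ : Potential} (hζ : ζ ∈ smoothSC) :
    SpaceCompact (divergence ζ) :=
  hζ.2.of_eq_zero fun x hx => by
    rw [divergence_eq hζ.1]
    simp [pd_low_eq_zero hx]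

lemma divergence_add_gradient {ζ : Potential} (hζ : ContDiff ℝ ∞ ζ) {χ : Minkowski → ℝ}
    (hχ : ContDiff ℝ ∞ χ) (x : Minkowski) :
    divergence (ζ + gradient χ) x = divergence ζ x + dAlembertian χ x := by
  have hs : ContDiff ℝ ∞ (ζ + gradient χ) := hζ.add (smooth_gradient hχ)
  rw [divergence_eq hs, divergence_eq hζ, dAlembertian_eq hχ,
    ← Finset.sum_add_distrib]
  refine Finset.sum_congr rfl fun μ _ => ?_
  rw [low_add, low_gradient, pd_add (diff_of_smooth (smooth_low hζ μ))
    (diff_of_smooth (smooth_pd hχ μ)), Pi.add_apply, mul_add]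

lemma pd_dAlembertian {χ : Minkowski → ℝ} (hχ : ContDiff ℝ ∞ χ) (ν : Fin 4) (x : Minkowski) :
    pd ν (dAlembertian χ) x = dAlembertian (pd ν χ) x := by
  rw [funext (dAlembertian_eq hχ), dAlembertian_eq (smooth_pd hχ ν), pd_sum _ fun μ _ =>
    (diff_of_smooth (smooth_pd (smooth_pd hχ μ) μ)).const_mul _]
  refine Finset.sum_congr rfl fun μ _ => ?_
  rw [pd_const_mul (diff_of_smooth (smooth_pd (smooth_pd hχ μ) μ)), pd_comm (smooth_pd hχ μ),
    funext (pd_comm hχ ν μ)]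

theorem exists_gaugeEquivalent_mem_YLor {ζ : Potential} (hζ : ζ ∈ YMaxTilde) :
    ∃ η ∈ YLor, GaugeEquivalent ζ η := by
  obtain ⟨hsc, hmax⟩ := hζ
  have hd := smooth_divergence hsc.1
  -- Then `□χ = -∂·ζ`, which cancels both the divergence and, after commuting `∂_ν` with `□`, the
  -- source term `∂_ν(∂·ζ)`.
  let χ := wavePotential (divergence ζ)
  have hχ : ContDiff ℝ ∞ χ := smooth_wavePotential hd
  have hbox : dAlembertian χ = -divergence ζ := funext (dAlembertian_wavePotential hd)
  have hdiv : ∀ x, divergence (ζ + gradient χ) x = 0 := fun x => by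
    rw [divergence_add_gradient hsc.1 hχ, hbox]
    simp
  have hη : ζ + gradient χ ∈ smoothSC := smoothSC.add_mem hsc
    (gradient_mem_smoothSC hχ (spaceCompact_wavePotential (spaceCompact_divergence hsc)))
  refine ⟨ζ + gradient χ, ⟨⟨hη, fun ν x => ?_⟩, hdiv⟩, χ, hχ, fun x μ => rfl⟩
  have h1 : dAlembertian (low (ζ + gradient χ) ν) x
      = dAlembertian (low ζ ν) x + dAlembertian (pd ν χ) x := by
    have hl := smooth_low hsc.1 ν
    have hp := smooth_pd hχ ν
    have hs : ContDiff ℝ ∞ (low ζ ν + pd ν χ) := hl.add hp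
    rw [low_add, low_gradient, dAlembertian_eq hs, dAlembertian_eq hl,
      dAlembertian_eq hp, ← Finset.sum_add_distrib]
    refine Finset.sum_congr rfl fun μ _ => ?_
    rw [pd_add (diff_of_smooth hl) (diff_of_smooth hp), pd_add
      (diff_of_smooth (smooth_pd hl μ)) (diff_of_smooth (smooth_pd hp μ)), Pi.add_apply, mul_add]
  rw [h1, (maxwell_iff hsc.1 ν x).1 (hmax ν x), ← pd_dAlembertian hχ, hbox]
  have : -divergence ζ = (-1 : ℝ) • divergence ζ := by simp
  rw [this, pd_smul (diff_of_smooth hd)]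
  simp

/-! ### Comparison of the two forms -/

lemma integral_pd_slice {h : Minkowski → ℝ} (hh : ContDiff ℝ ∞ h) (t : ℝ) {C : Set (Fin 3 → ℝ)}
    (hC : IsCompact C) (h0 : ∀ x ∉ C, h (spacetime t x) = 0) (i : Fin 3) :
    Integrable (fun x => pd i.succ h (spacetime t x)) ∧
      ∫ x, pd i.succ h (spacetime t x) = 0 := by
  let g : (Fin 3 → ℝ) → ℝ := fun x => h (spacetime t x)
  have hg : ContDiff ℝ ∞ g := hh.comp (contDiff_spacetime t)
  have hgs : HasCompactSupport g := HasCompactSupport.intro hC h0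
  have hd : ∀ x, fderiv ℝ g x (Pi.single i 1) = pd i.succ h (spacetime t x) := fun x => by
    have h1 := (((diff_of_smooth hh) (spacetime t x)).hasFDerivAt.comp x
      (hasFDerivAt_spacetime t x)).fderiv
    change fderiv ℝ g x = _ at h1
    rw [h1, ContinuousLinearMap.comp_apply, spaceInclusion_apply, pd]
    congr 1
    funext j
    refine Fin.cases ?_ (fun k => ?_) j
    · simp [spacetime]
    · simp [spacetime, Pi.single_apply]
  have hcont : Continuous fun x => fderiv ℝ g x (Pi.single i 1) :=
    (hg.continuous_fderiv (by simp)).clm_apply continuous_const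
  have hint : Integrable fun x => fderiv ℝ g x (Pi.single i 1) :=
    hcont.integrable_of_hasCompactSupport (hgs.fderiv_apply ℝ _)
  simp only [hd] at hint
  refine ⟨hint, ?_⟩
  -- Integration by parts against the constant function `1`.
  have := integral_mul_fderiv_eq_neg_fderiv_mul_of_integrable (μ := volume) (𝕜 := ℝ)
    (f := fun _ : Fin 3 → ℝ => (1 : ℝ)) (g := g) (v := Pi.single i 1) (by simp)
    (by simpa [hd] using hint)
    (by simpa using hg.continuous.integrable_of_hasCompactSupport hgs)
    (fun x _ => differentiableAt_const _) (fun x _ => hg.differentiable (by simp) x)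
  simpa [hd] using this

lemma integral_sum_pd_slice {h : Fin 3 → Minkowski → ℝ} (hh : ∀ i, ContDiff ℝ ∞ (h i)) (t : ℝ)
    {C : Set (Fin 3 → ℝ)} (hC : IsCompact C) (h0 : ∀ i, ∀ x ∉ C, h i (spacetime t x) = 0) :
    Integrable (fun x => ∑ i, pd i.succ (h i) (spacetime t x)) ∧
      ∫ x, ∑ i, pd i.succ (h i) (spacetime t x) = 0 := by
  have H := fun i => integral_pd_slice (hh i) t hC (h0 i) i
  refine ⟨integrable_finsetSum _ fun i _ => (H i).1, ?_⟩
  rw [integral_finsetSum _ fun i _ => (H i).1]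
  exact Finset.sum_eq_zero fun i _ => (H i).2

lemma jMax_zero_eq {ζ η : Potential} (hζ : ζ ∈ YLor) (hη : η ∈ YLor) (x : Minkowski) :
    jMax 0 ζ η x = jVec 0 ζ η x + ∑ i : Fin 3, pd i.succ (fun y =>
      low ζ 0 y * low η i.succ y - low ζ i.succ y * low η 0 y) x := by
  have hl := fun μ => smooth_low hζ.1.1.1 μ
  have hm := fun μ => smooth_low hη.1.1.1 μ
  have h1 := hζ.2 x
  have h2 := hη.2 x
  rw [divergence_eq hζ.1.1.1] at h1
  rw [divergence_eq hη.1.1.1] at h2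
  have hp : ∀ i : Fin 3, pd i.succ (fun y =>
      low ζ 0 y * low η i.succ y - low ζ i.succ y * low η 0 y) x
      = low ζ 0 x * pd i.succ (low η i.succ) x + low η i.succ x * pd i.succ (low ζ 0) x
      - (low ζ i.succ x * pd i.succ (low η 0) x + low η 0 x * pd i.succ (low ζ i.succ) x) := by
    intro i
    rw [← pd_mul (diff_of_smooth (hl _)) (diff_of_smooth (hm _)),
      ← pd_mul (diff_of_smooth (hl _)) (diff_of_smooth (hm _))]
    exact congrFun (pd_sub (diff_of_smooth ((hl _).mul (hm _)))
      (diff_of_smooth ((hl _).mul (hm _))) _) x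
  simp only [hp, jMax, jVec, pdUp_up hη.1.1.1, pd_up hζ.1.1.1]
  simp only [pdUp_eq, up_eq, Pi.smul_apply,
    smul_eq_mul, Fin.sum_univ_four, Fin.sum_univ_three] at h1 h2 ⊢
  simp [sig] at h1 h2 ⊢
  -- Before the Lorentz conditions are used, the defect is exactly `η₀ ∂·ζ - ζ₀ ∂·η`.
  linear_combination (low η 0 x) * h1 - (low ζ 0 x) * h2

lemma omegaMaxTilde_inclusion (t : ℝ) (ζ η : YLor) :
    omegaMaxTilde t (Submodule.inclusion YLor_le_YMaxTilde ζ)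
      (Submodule.inclusion YLor_le_YMaxTilde η) = omegaLor t ζ η := by
  rw [omegaMaxTilde_apply, omegaLor_apply, omegaVec_apply]
  simp only [Submodule.coe_inclusion]
  obtain ⟨C, hC, h0⟩ := slice_compact ζ.2.1.1.2 t
  have hl := fun μ => smooth_low ζ.2.1.1.1 μ
  have hm := fun μ => smooth_low η.2.1.1.1 μ
  have H := integral_sum_pd_slice (h := fun i y => low ζ 0 y * low η i.succ y
      - low ζ i.succ y * low η 0 y) (fun i => ((hl _).mul (hm _)).sub ((hl _).mul (hm _))) t hC
    (fun i x hx => by simp [low, h0 x hx])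
  simp only [jMax_zero_eq ζ.2 η.2]
  rw [integral_add (integrable_jVec ζ.2.1.1 η.2.1.1 0 t) H.1, H.2, add_zero]

/-! ### Gauge directions lie in the kernel -/

lemma jMax_zero_gradient {ζ : Potential} (hζ : ζ ∈ YMaxTilde) {χ : Minkowski → ℝ}
    (hχ : ContDiff ℝ ∞ χ) (x : Minkowski) :
    jMax 0 ζ (gradient χ) x = ∑ i : Fin 3, pd i.succ (fun y =>
      (pd i.succ (low ζ 0) y - pd 0 (low ζ i.succ) y) * χ y) x := by
  have hl := fun μ => smooth_low hζ.1.1 μ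
  have hF := fun i : Fin 3 => (smooth_pd (hl 0) i.succ).sub (smooth_pd (hl i.succ) 0)
  have hp : ∀ i : Fin 3, pd i.succ (fun y =>
      (pd i.succ (low ζ 0) y - pd 0 (low ζ i.succ) y) * χ y) x
      = (pd i.succ (low ζ 0) x - pd 0 (low ζ i.succ) x) * pd i.succ χ x
      + χ x * (pd i.succ (pd i.succ (low ζ 0)) x - pd i.succ (pd 0 (low ζ i.succ)) x) := by
    intro i
    have h2 := congrFun (pd_sub (diff_of_smooth (smooth_pd (hl 0) i.succ))
      (diff_of_smooth (smooth_pd (hl i.succ) 0)) i.succ) x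
    exact (pd_mul (diff_of_smooth (hF i)) (diff_of_smooth hχ) _ x).trans
      (congrArg (fun z => _ + χ x * z) h2)
  -- Gauss's law: the `ν = 0` Maxwell equation says that the electric field is divergence-free. The
  -- field strength of the gradient drops out by symmetry of second derivatives.
  have h1 := (maxwell_iff hζ.1.1 0 x).1 (hζ.2 0 x)
  rw [dAlembertian_eq (hl 0), pd_divergence hζ.1.1] at h1
  simp only [hp, jMax, pdUp_up (smooth_gradient hχ), pd_up hζ.1.1]
  simp only [pdUp_eq, up_eq, low_gradient, Pi.smul_apply, smul_eq_mul, Fin.sum_univ_four,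
    Fin.sum_univ_three, pd_comm hχ 0 1, pd_comm hχ 0 2, pd_comm hχ 0 3] at h1 ⊢
  simp [sig] at h1 ⊢
  linear_combination -(χ x) * h1

lemma mem_ker_omegaMaxTilde (t : ℝ) {g : YMaxTilde} {χ : Minkowski → ℝ}
    (hχ : ContDiff ℝ ∞ χ) (hg : (g : Potential) = gradient χ) :
    g ∈ LinearMap.ker (omegaMaxTilde t) := by
  rw [LinearMap.mem_ker]
  ext ζ
  rw [LinearMap.zero_apply, ← (omegaMaxTilde_isAlt t).neg_eq, neg_eq_zero, omegaMaxTilde_apply, hg]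
  simp only [jMax_zero_gradient ζ.2 hχ]
  -- Compact support on the slice comes from the field strength of `ζ`, so none is required of `χ`.
  -- The trivial entry `μ = 0` only makes this a four-component field, as `slice_compact` expects.
  have hsF : SpaceCompact fun y μ => pd μ (low ζ 0) y - pd 0 (low ζ μ) y :=
    ζ.2.1.2.of_eq_zero fun x hx => by
      funext μ
      simp [pd_low_eq_zero hx]
  obtain ⟨C, hC, h0⟩ := slice_compact hsF t
  have hl := fun μ => smooth_low ζ.2.1.1 μ
  refine (integral_sum_pd_slice (h := fun i y =>
    (pd i.succ (low ζ 0) y - pd 0 (low ζ i.succ) y) * χ y) (fun i =>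
      ((smooth_pd (hl 0) i.succ).sub (smooth_pd (hl i.succ) 0)).mul hχ) t hC
    (fun i x hx => ?_)).2
  simp [congrFun (h0 x hx) i.succ]

/-! ### Passage to the quotients -/

lemma exists_YLor_sub_mem_ker (t : ℝ) (ζ : YMaxTilde) :
    ∃ η : YLor, Submodule.inclusion YLor_le_YMaxTilde η - ζ
      ∈ LinearMap.ker (omegaMaxTilde t) := by
  obtain ⟨η, hη, χ, hχ, h⟩ := exists_gaugeEquivalent_mem_YLor ζ.2
  refine ⟨⟨η, hη⟩, mem_ker_omegaMaxTilde t hχ ?_⟩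
  funext x μ
  simp [h, gradient]

/-- A field of `YLor` orthogonal to `YLor` is orthogonal to all of `YMaxTilde`, since any test field
may be moved into `YLor` by an element of the kernel. One inclusion makes the map of quotients well
defined, the other makes it injective. -/
lemma ker_omegaLor (t : ℝ) : LinearMap.ker (omegaLor t) = (LinearMap.ker (omegaMaxTilde t)).comap
    (Submodule.inclusion YLor_le_YMaxTilde) := by
  ext ζ
  rw [Submodule.mem_comap, LinearMap.mem_ker, LinearMap.mem_ker]
  constructor
  · intro h
    ext w
    obtain ⟨η, hη⟩ := exists_YLor_sub_mem_ker t w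
    have h1 := omegaMaxTilde_inclusion t ζ η
    have h2 : omegaMaxTilde t (Submodule.inclusion YLor_le_YMaxTilde η - w)
        (Submodule.inclusion YLor_le_YMaxTilde ζ) = 0 := by
      rw [LinearMap.mem_ker.1 hη, LinearMap.zero_apply]
    rw [← (omegaMaxTilde_isAlt t).neg_eq, neg_eq_zero, map_sub, h1, h] at h2
    simpa using h2
  · intro h
    ext η
    rw [← omegaMaxTilde_inclusion, h]
    rfl

/-- The map of symplectic reductions induced by the inclusion of `YLor` in `YMaxTilde`. -/
noncomputable def lorentzToMaxwell (t : ℝ) : YLorRed t →ₗ[ℝ] YMax t :=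
  Submodule.mapQ _ _ (Submodule.inclusion YLor_le_YMaxTilde) (ker_omegaLor t).le

lemma lorentzToMaxwell_bijective (t : ℝ) : Function.Bijective (lorentzToMaxwell t) := by
  constructor
  · rw [← LinearMap.ker_eq_bot, lorentzToMaxwell, Submodule.mapQ, Submodule.ker_liftQ,
      LinearMap.ker_comp, Submodule.ker_mkQ, ← ker_omegaLor, Submodule.mkQ_map_self]
  · intro w
    obtain ⟨ζ, rfl⟩ := Submodule.Quotient.mk_surjective _ w
    obtain ⟨η, hη⟩ := exists_YLor_sub_mem_ker t ζ
    exact ⟨Submodule.Quotient.mk η, (Submodule.Quotient.eq _).2 hη⟩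

end MaxwellFields

open MaxwellFields in
theorem mainTheorem7 (t : ℝ) :
    (∀ ζ ∈ YMaxTilde, ∃ η ∈ YLor, GaugeEquivalent ζ η) ∧
    ∃ (hle : YLor ≤ YMaxTilde) (e : YLorRed t ≃ₗ[ℝ] YMax t),
      (∀ ζ : YLor, e (Submodule.Quotient.mk ζ)
        = Submodule.Quotient.mk (Submodule.inclusion hle ζ)) ∧
      ∀ a b : YLorRed t, omegaMax t (e a) (e b) = omegaLorRed t a b := by
  refine ⟨fun ζ hζ => exists_gaugeEquivalent_mem_YLor hζ, YLor_le_YMaxTilde,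
    LinearEquiv.ofBijective (lorentzToMaxwell t) (lorentzToMaxwell_bijective t),
    fun ζ => rfl, fun a b => ?_⟩
  obtain ⟨ζ, rfl⟩ := Submodule.Quotient.mk_surjective _ a
  obtain ⟨η, rfl⟩ := Submodule.Quotient.mk_surjective _ b
  exact omegaMaxTilde_inclusion t ζ η
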